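/- **Model.** Time is measured in slots $t=0,1,2,\dots$; round $j\ge 0$ starts at time $j\tau_{\rm r}$ and lasts $\tau_{\rm r}$ slots. A single sensor at $\mathbf x$ in a measurable planar region $\Phi$ with area $0<|\Phi|<\infty$ senses at the start of each round with probability $p_{\rm s}>0$ and chooses edge computing (mode $\mathrm e$) with probability $p_{\rm e}$, otherwise local computing (mode $\ell$). Sensing takes one slot, computing takes $\tau_m$ slots in mode $m\in\{\mathrm e,\ell\}$, and the data is transmitted, one slot per attempt, until the first success, at most $\delta\ge 1$ times; then it is dropped. An attempt in mode $m$ fails if $W\log_2(1+\gamma)<R_m$, where $\gamma$ is its SINR; this has probability $p_{{\rm o},m}<1$. All sensing decisions, computing decisions and SINRs are independent, and $1+\delta+\tau_m\le\tau_{\rm r}$ for both modes. Hence a round in which the sensor senses in mode $m$ and the $c$-th attempt is the first success ($1\le c\le\delta$) causes an update of the sink $1+c+\tau_m$ slots after the start of the round. The age of information $\Delta(t)$ is $t$ minus the generation time (start of the round of sensing) of the most recent data at the sink, the sink initially holding data generated at time $0$. **Coverage.** With $\beta_1,\beta_2>0$ and $\epsilon_0<1$, data of age $a$ covers the points $\mathbf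 y$ with $1-\exp(-2\beta_1\|\mathbf x-\mathbf y\|-2\beta_2a)\le\epsilon_0$. Let $\phi_{\rm cov}(t)$ be the area of the part of $\Phi$ covered with age $a=\Delta(t)$, divided by $|\Phi|$. For $\eta>0$ let $\mathcal P_{\rm c}(\eta)=\mathbb P[\phi_{\rm cov}(t)\ge\eta]$ in steady state, i.e. the limit, as $T\to\infty$, both of $\frac1T\sum_{t<T}\mathbb P[\phi_{\rm cov}(t)\ge\eta]$ and, almost surely, of the fraction of slots $t<T$ with $\phi_{\rm cov}(t)\ge\eta$; $\mathbb P[\Delta>v]$ is understood in the same way. Assume that $\Phi$ contains the covered set for every age $a\ge 2+\min(\tau_{\rm e},\tau_\ell)$, or that $\Phi$ contains the closed disc about $\mathbf x$ of radius $\sqrt{\eta|\Phi|/\pi}$. **Notation.** $\zeta_m(c)=1-p_{{\rm o},m}^{\,c}$, $\;p_x=p_{\rm s}\{p_{\rm e}\zeta_{\rm e}(\delta)+(1-p_{\rm e})\zeta_\ell(\delta)\}$, $$p'_{\rm e}=\frac{p_{\rm e}\zeta_{\rm e}(\delta)}{p_{\rm e}\zeta_{\rm e}(\delta)+(1-p_{\rm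 e})\zeta_\ell(\delta)},\quad p'_\ell=1-p'_{\rm e},\qquad v_{\rm th}=-\frac{\beta_1}{\beta_2}\sqrt{\frac{\eta|\Phi|}{\pi}}-\frac{\log(1-\epsilon_0)}{2\beta_2},$$ $F_m=\frac1{\zeta_m(1)}-\frac{\delta p_{{\rm o},m}^{\delta}}{\zeta_m(\delta)}$, $\;H_m(y)=1+\delta+\tau_m+\tau_{\rm r}(y-1)$, $\;n=\lfloor v_{\rm th}\rfloor$, $\;f_m(y)=n-\tau_m-\tau_{\rm r}y-1$. For modes $m',m$ put $a=n-1-\tau_{m'}$; then $G(m',m)$ equals 1. $\frac{\tau_{\rm r}}{p_x}+\tau_m-\tau_{m'}+F_m-F_{m'}$ if $v_{\rm th}<2+\tau_{m'}$; 2. $\frac{\tau_{\rm r}}{p_x}+\tau_m-\tau_{m'}+F_m-\frac{n-\tau_{m'}-p_{{\rm o},m'}^{a}-\delta p_{{\rm o},m'}^{\delta}}{\zeta_{m'}(\delta)}-\frac{p_{{\rm o},m'}^{a}-p_{{\rm o},m'}^{\delta}}{\zeta_{m'}(\delta)\zeta_{m'}(1)}$ if $2+\tau_{m'}\le v_{\rm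 th}<1+\delta+\tau_{m'}$; 3. $\frac{\tau_{\rm r}}{p_x}+\tau_m+F_m-n$ if $1+\delta+\tau_{m'}\le v_{\rm th}<\tau_{\rm r}+2+\tau_m$; 4. with $f=f_m(y)$, $\;(1-p_x)^{y-1}\Big[(1-p_x)\big\{H_m(y)+\frac{\tau_{\rm r}}{p_x}-\frac{\delta}{\zeta_m(\delta)}+\frac1{\zeta_m(1)}\big\}+(1-\tau_{\rm r}+n)\big\{\frac{p_x\zeta_m(f)}{\zeta_m(\delta)}-1\big\}+\frac{p_x}{\zeta_m(\delta)}\big\{p_{{\rm o},m}^{f}(n-\tau_{\rm r})-p_{{\rm o},m}^{\delta}H_m(y)+\frac{p_{{\rm o},m}^{f}-p_{{\rm o},m}^{\delta}}{\zeta_m(1)}\big\}\Big]$ if $y\tau_{\rm r}+2+\tau_m\le v_{\rm th}<y\tau_{\rm r}+1+\delta+\tau_m$, $y=1,2,\dots$; 5. $(1-p_x)^y\big\{-f_m(y)-1+\frac{\tau_{\rm r}}{p_x}+\frac1{\zeta_m(1)}+\delta\big(1-\frac1{\zeta_m(\delta)}\big)\big\}$ if $y\tau_{\rm r}+1+\delta+\tau_m\le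 v_{\rm th}<(y+1)\tau_{\rm r}+2+\tau_m$, $y=1,2,\dots$. For consecutive updates $k-1,k$ let $Z_k$ be the time from sensing to the $k$-th update, $X_k$ the time from the start of the first round after the $(k-1)$-th update's round to the $k$-th update, $U_k=\tau_{\rm r}-Z_{k-1}+X_k$ the inter-update time, and let the violation time $g_k$ be $\tau_{\rm r}+X_k-Z_{k-1}$ if $v_{\rm th}<Z_{k-1}$, $\tau_{\rm r}+X_k-(\lfloor v_{\rm th}\rfloor+1)$ if $Z_{k-1}\le v_{\rm th}<\tau_{\rm r}+X_k$, and $0$ otherwise. **Claim.** The steady-state probabilities exist, $U_k$ and $g_k$ are integrable, and $$\mathcal P_{\rm c}(\eta)=1-\mathbb P[\Delta>v_{\rm th}]=1-\frac{p_x}{\tau_{\rm r}}\sum_{m'\in\{{\rm e},\ell\}}\sum_{m\in\{{\rm e},\ell\}}p'_{m'}p'_{m}\,G(m',m),$$ where $\mathbb P[\Delta>v_{\rm th}]=\mathbb E[g_k]/\mathbb E[U_k]$, $\;\mathbb E[U_k]=\tau_{\rm r}/p_x$ and $\mathbb E[g_k]=\sum_{m'}\sum_m p'_{m'}p'_mG(m',m)$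 for every pair of consecutive updates. -/

import Mathlib

open MeasureTheory ProbabilityTheory Filter Topology

/-- Computing decision: at the edge server (`ec`) or locally at the sensor (`lc`). -/
inductive Mode where
  | ec
  | lc

instance : MeasurableSpace Mode := ⊤

/-- The plane with the Euclidean metric and Lebesgue measure. -/
abbrev Plane := EuclideanSpace ℝ (Fin 2)

/-- Index set of the primitive random variables: the sensing decision of round `j`, the computing
decision of round `j`, and the SINR of the `c`-th transmission attempt of round `j`. -/
inductive Source where
  | sense (j : ℕ)
  | comp (j : ℕ)
  | sinr (j c : ℕ)

/-- Value space of each primitive random variable. -/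
abbrev Source.Val : Source → Type
  | .sense _ => Bool
  | .comp _ => Mode
  | .sinr _ _ => ℝ

instance : (i : Source) → MeasurableSpace i.Val
  | .sense _ => inferInstanceAs (MeasurableSpace Bool)
  | .comp _ => inferInstanceAs (MeasurableSpace Mode)
  | .sinr _ _ => inferInstanceAs (MeasurableSpace ℝ)

/-- Numerical data of the single-sensor network; time is measured in slots. -/
structure Network where
  /-- slots per round -/
  τr : ℕ
  /-- maximal number of transmission attempts for one data item -/
  δ : ℕ
  /-- computing time for each computing mode -/
  τ : Mode → ℕ
  /-- sensing probability -/
  ps : ℝ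
  /-- probability of choosing edge computing -/
  pe : ℝ
  /-- bandwidth -/
  W : ℝ
  /-- target data rate for each computing mode -/
  R : Mode → ℝ
  /-- outage probability of one transmission attempt for each computing mode -/
  po : Mode → ℝ
  /-- weight of the spatial error -/
  β₁ : ℝ
  /-- weight of the temporal error -/
  β₂ : ℝ
  /-- error threshold -/
  ε₀ : ℝ
  /-- target coverage ratio -/
  η : ℝ
  /-- location of the sensor -/
  x : Plane
  /-- network region -/
  Φ : Set Plane

noncomputable section

namespace Network

variable (N : Network)

/-! ### The random model -/

section Dynamics

variable {Ω : Type*} (ξ : (i : Source) → Ω → i.Val)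

/-- The `c`-th transmission attempt of round `j` would fail for data computed in mode `m`. -/
def Outage (m : Mode) (j c : ℕ) (ω : Ω) : Prop :=
  N.W * Real.logb 2 (1 + (ξ (.sinr j c) ω : ℝ)) < N.R m

/-- The primitive variables are independent and have the prescribed marginals. -/
structure IsModel [MeasurableSpace Ω] (μ : Measure Ω) : Prop where
  measurable : ∀ i, Measurable (ξ i)
  indep : iIndepFun ξ μ
  sense_prob : ∀ j, μ.real {ω | (ξ (.sense j) ω : Bool) = true} = N.ps
  comp_prob : ∀ j, μ.real {ω | (ξ (.comp j) ω : Mode) = Mode.ec} = N.pe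
  outage_prob : ∀ m j c, μ.real {ω | N.Outage ξ m j c ω} = N.po m

/-- Computing decision of round `j`. -/
def mode (j : ℕ) (ω : Ω) : Mode := ξ (.comp j) ω

/-- Round `j` leads to a successful update: the sensor senses, and one of the at most `δ`
transmission attempts, numbered `1, …, δ`, does not fail. -/
def Success (j : ℕ) (ω : Ω) : Prop :=
  (ξ (.sense j) ω : Bool) = true ∧
    ∃ c, 1 ≤ c ∧ c ≤ N.δ ∧ ¬ N.Outage ξ (mode ξ j ω) j c ω

/-- Number of the first successful transmission attempt of round `j`. -/
def attempts (j : ℕ) (ω : Ω) : ℕ :=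
  sInf {c | 1 ≤ c ∧ ¬ N.Outage ξ (mode ξ j ω) j c ω}

/-- Time from the sensing instant (the start of round `j`) to the update at the sink caused by a
successful round `j`: one slot of sensing, the transmissions, and the computation. -/
def delay (j : ℕ) (ω : Ω) : ℕ := 1 + N.attempts ξ j ω + N.τ (mode ξ j ω)

open Classical in
/-- Generation time of the most recent data available at the sink at time `t`. Initially the sink
holds data generated at time `0`. -/
def lastGen (t : ℕ) (ω : Ω) : ℕ :=
  ((Finset.range (t + 1)).filter
    (fun j => N.Success ξ j ω ∧ j * N.τr + N.delay ξ j ω ≤ t)).sup (fun j => j * N.τr)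

/-- Age of information at the sink at time `t`. -/
def aoi (t : ℕ) (ω : Ω) : ℝ := (t : ℝ) - (N.lastGen ξ t ω : ℝ)

open Classical in
/-- The round that causes the `k`-th successful update, `k = 0, 1, …`. -/
def updateRound (k : ℕ) (ω : Ω) : ℕ := Nat.nth (fun j => N.Success ξ j ω) k

/-- `Z_k`: time from sensing to the `k`-th successful update. -/
def Z (k : ℕ) (ω : Ω) : ℝ := (N.delay ξ (N.updateRound ξ k ω) ω : ℝ)

/-- Time of the `k`-th successful update. -/
def updateTime (k : ℕ) (ω : Ω) : ℝ := (N.updateRound ξ k ω : ℝ) * N.τr + N.Z ξ k ω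

/-- `X_k`: time from the start of the first round after the `(k-1)`-th successful update to the
`k`-th successful update (`k ≥ 1`). -/
def X (k : ℕ) (ω : Ω) : ℝ :=
  N.updateTime ξ k ω - ((N.updateRound ξ (k - 1) ω : ℝ) + 1) * N.τr

/-- `U_k`: time between the `(k-1)`-th and the `k`-th successful update (`k ≥ 1`). -/
def U (k : ℕ) (ω : Ω) : ℝ := N.updateTime ξ k ω - N.updateTime ξ (k - 1) ω

/-- `g_k`: violation time of the target age `v` between the `(k-1)`-th and the `k`-th successful
update (`k ≥ 1`). -/
def g (v : ℝ) (k : ℕ) (ω : Ω) : ℝ :=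
  if v < N.Z ξ (k - 1) ω then N.τr + N.X ξ k ω - N.Z ξ (k - 1) ω
  else if v < N.τr + N.X ξ k ω then N.τr + N.X ξ k ω - ((⌊v⌋ : ℝ) + 1)
  else 0

end Dynamics

/-! ### Coverage -/

/-- Error of estimating the data at distance `d` from the sensor by data of age `a`. -/
def estError (d a : ℝ) : ℝ := 1 - Real.exp (-N.β₁ * d - N.β₂ * a) ^ 2

/-- Sensing coverage with data of age `a`: the points at which the error is at most `ε₀`. -/
def coverage (a : ℝ) : Set Plane := {y | N.estError (dist N.x y) a ≤ N.ε₀}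

/-- Area of the network region. -/
def area : ℝ := volume.real N.Φ

/-- Network coverage ratio with data of age `a`. -/
def coverageRatio (a : ℝ) : ℝ := volume.real (N.coverage a ∩ N.Φ) / N.area

/-- Radius of a disc of area `η |Φ|`. -/
def targetRadius : ℝ := √(N.η * N.area / Real.pi)

/-- Target age of information. -/
def vth : ℝ := -(N.β₁ / N.β₂) * N.targetRadius - Real.log (1 - N.ε₀) / (2 * N.β₂)

/-! ### The closed form -/

/-- Probability `1 - p_o ^ c` that one of `c` transmission attempts succeeds. -/
def ζ (m : Mode) (c : ℤ) : ℝ := 1 - N.po m ^ c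

/-- Probability that a round leads to a successful update. -/
def px : ℝ := N.ps * (N.pe * N.ζ .ec N.δ + (1 - N.pe) * N.ζ .lc N.δ)

/-- Probability of each computing mode, conditioned on a successful update. -/
def pcond : Mode → ℝ
  | .ec => N.pe * N.ζ .ec N.δ / (N.pe * N.ζ .ec N.δ + (1 - N.pe) * N.ζ .lc N.δ)
  | .lc => (1 - N.pe) * N.ζ .lc N.δ / (N.pe * N.ζ .ec N.δ + (1 - N.pe) * N.ζ .lc N.δ)

def F₁ (m : Mode) : ℝ := 1 / N.ζ m 1 - N.δ * N.po m ^ N.δ / N.ζ m N.δ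

def F₂ (m : Mode) (y : ℕ) : ℝ := 1 + N.δ + N.τ m + N.τr * ((y : ℝ) - 1)

def F₃ (v : ℝ) (m : Mode) (y : ℕ) : ℤ := ⌊v⌋ - N.τ m - N.τr * y - 1

def v₁ (m' : Mode) : ℝ := 2 + N.τ m'

def v₂ (m' : Mode) : ℝ := 1 + N.δ + N.τ m'

def v₃ (m : Mode) (y : ℕ) : ℝ := y * N.τr + 2 + N.τ m

def v₄ (m : Mode) (y : ℕ) : ℝ := y * N.τr + 1 + N.δ + N.τ m

/-- For `v ≥ v₃ m 1`, the only `y ≥ 1` with `v₃ m y ≤ v < v₃ m (y + 1)`. -/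
def yIdx (v : ℝ) (m : Mode) : ℕ := ⌊(v - 2 - N.τ m) / N.τr⌋₊

/-- The function `G(m', m)` for the target age `v`, where `m'` is the mode of the previous and `m`
the mode of the current update. -/
def G (v : ℝ) (m' m : Mode) : ℝ :=
  let y := N.yIdx v m
  let f := N.F₃ v m y
  let a : ℤ := ⌊v⌋ - 1 - N.τ m'
  if v < N.v₁ m' then
    N.τr / N.px + N.τ m - N.τ m' + N.F₁ m - N.F₁ m'
  else if v < N.v₂ m' then
    N.τr / N.px + N.τ m - N.τ m' + N.F₁ m
      - (⌊v⌋ - N.τ m' - N.po m' ^ a - N.δ * N.po m' ^ N.δ) / N.ζ m' N.δ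
      - (N.po m' ^ a - N.po m' ^ N.δ) / (N.ζ m' N.δ * N.ζ m' 1)
  else if v < N.v₃ m 1 then
    N.τr / N.px + N.τ m + N.F₁ m - ⌊v⌋
  else if v < N.v₄ m y then
    (1 - N.px) ^ (y - 1) *
      ((1 - N.px) * (N.F₂ m y + N.τr / N.px - N.δ / N.ζ m N.δ + 1 / N.ζ m 1)
        + (1 - N.τr + ⌊v⌋) * (N.px * N.ζ m f / N.ζ m N.δ - 1)
        + N.px / N.ζ m N.δ *
          (N.po m ^ f * (⌊v⌋ - N.τr) - N.po m ^ N.δ * N.F₂ m y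
            + (N.po m ^ f - N.po m ^ N.δ) / N.ζ m 1))
  else
    (1 - N.px) ^ y *
      (-f - 1 + N.τr / N.px + 1 / N.ζ m 1 + N.δ * (1 - 1 / N.ζ m N.δ))

/-- The closed form `Σ_{m'} Σ_m p'_{m'} p'_m G(m', m)` of the expected violation time. -/
def meanViolation (v : ℝ) : ℝ :=
  N.pcond .ec * N.pcond .ec * N.G v .ec .ec + N.pcond .ec * N.pcond .lc * N.G v .ec .lc
    + N.pcond .lc * N.pcond .ec * N.G v .lc .ec + N.pcond .lc * N.pcond .lc * N.G v .lc .lc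

end Network

open Classical in
/-- `p` is the steady-state probability of the time-dependent event `E t`, `t = 0, 1, …`: the
probability that `E` holds at a slot drawn uniformly from the first `T` slots tends to `p` as
`T → ∞`, and almost surely the fraction of the first `T` slots in which `E` holds tends to `p`. -/
def IsSteadyStateProb {Ω : Type*} [MeasurableSpace Ω] (μ : Measure Ω) (E : ℕ → Set Ω) (p : ℝ) :
    Prop :=
  Tendsto (fun T : ℕ => (∑ t ∈ Finset.range T, μ.real (E t)) / (T : ℝ)) atTop (𝓝 p) ∧
  ∀ᵐ ω ∂μ, Tendsto
    (fun T : ℕ => (((Finset.range T).filter (fun t => ω ∈ E t)).card : ℝ) / (T : ℝ)) atTop (𝓝 p)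

end

/-!
Encode round `j` by its lag: the time from its start to the update it causes, or `0` if it causes
none. The lags of different rounds are independent, and a lag lies in `[1, d]` with a probability
`D d`, which is `p_x` for `d ≥ τ_r`.

After an initial phase, the age at slot `t` is at least `κ` iff none of the finitely many rounds
that started less than `κ` slots before `t` has delivered by `t`. This event has a probability that
is a product of factors `1 - D`, and it depends on `t` only through `t mod τ_r`. Events of slots
that lie far apart are independent, so the strong law of large numbers along residue classes gives
both forms of the steady-state probability, as the average of the products over one period.

Let `A` be the time from the start of an updating round to the next update, and `Z` the lag of that
round. From one update to the next the age runs through the integers `a` with `Z ≤ a < A`, so the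
violation time of the threshold `κ` counts those with `a ≥ κ`. The event `Z ≤ a < A` says that the
round delivered within `a` slots and the rounds after it have not delivered by then, whence its
probability is `D a / D τ_r` times the product for age `a`. The sum over one period of the products
for thresholds `κ` and `κ + 1` differs by exactly `D κ` times such a product, which identifies the
steady-state probability with `E[g] / E[U]`.

The closed form comes from conditioning on the modes of both updates: the tail of `A` drops by the
factor `1 - p_x` per round, so each regime of `G` reduces to a finite geometric sum in the outage
probability. Finally, data of age `a` covers a disc about the sensor whose radius decreases with
`a`, and this disc has the target area exactly at the age `v_th`.
-/

/-! ### Cesàro means -/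

/-- The averages of the first `n` terms of `u` converge to `c`. -/
def HasCesaroMean (u : ℕ → ℝ) (c : ℝ) : Prop :=
  Tendsto (fun n : ℕ => (∑ i ∈ Finset.range n, u i) / (n : ℝ)) atTop (𝓝 c)

section Cesaro

variable {u w : ℕ → ℝ} {a b c : ℝ}

theorem hasCesaroMean_const (c : ℝ) : HasCesaroMean (fun _ => c) c := by
  refine tendsto_const_nhds.congr' ?_
  filter_upwards [eventually_ne_atTop 0] with n hn
  rw [Finset.sum_const, Finset.card_range, nsmul_eq_mul,
    mul_div_cancel_left₀ _ (Nat.cast_ne_zero.2 hn)]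

theorem HasCesaroMean.unique (ha : HasCesaroMean u a) (hb : HasCesaroMean u b) : a = b :=
  tendsto_nhds_unique ha hb

theorem HasCesaroMean.sub (hu : HasCesaroMean u a) (hw : HasCesaroMean w b) :
    HasCesaroMean (fun n => u n - w n) (a - b) :=
  (Tendsto.sub hu hw).congr fun n => by rw [Finset.sum_sub_distrib, sub_div]

theorem HasCesaroMean.of_shift (k : ℕ) (h : HasCesaroMean (fun n => u (k + n)) c) :
    HasCesaroMean u c := by
  have hsum := ((tendsto_const_div_atTop_nhds_zero_nat (∑ i ∈ Finset.range k, u i)).add h).mul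
    (tendsto_natCast_div_add_atTop (k : ℝ))
  rw [zero_add, mul_one] at hsum
  refine (tendsto_add_atTop_iff_nat k).1 (hsum.congr' ?_)
  filter_upwards [eventually_gt_atTop 0] with n hn
  rw [add_comm n k, Finset.sum_range_add, Nat.cast_add, add_comm (k : ℝ)]
  field_simp

theorem hasCesaroMean_congr (h : u =ᶠ[atTop] w) : HasCesaroMean u c ↔ HasCesaroMean w c := by
  suffices himp : ∀ {u w : ℕ → ℝ}, u =ᶠ[atTop] w → HasCesaroMean u c → HasCesaroMean w c from
    ⟨himp h, himp h.symm⟩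
  intro u w huw hu
  obtain ⟨k, hk⟩ := eventually_atTop.1 huw
  have hadd := hu.add (tendsto_const_div_atTop_nhds_zero_nat (∑ i ∈ Finset.range k, (w i - u i)))
  rw [add_zero] at hadd
  refine hadd.congr' ?_
  filter_upwards [eventually_ge_atTop k] with n hn
  obtain ⟨s, rfl⟩ := Nat.exists_eq_add_of_le hn
  rw [← add_div, Finset.sum_range_add u, Finset.sum_range_add w, Finset.sum_sub_distrib,
    Finset.sum_congr rfl fun i _ => hk (k + i) (Nat.le_add_right _ _)]
  ring

/-- There are `(n + (Q - 1 - r)) / Q` indices below `n` congruent to `r < Q` modulo `Q`. -/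
theorem sum_range_eq_sum_residues {Q : ℕ} (hQ : 0 < Q) (u : ℕ → ℝ) (n : ℕ) :
    ∑ t ∈ Finset.range n, u t =
      ∑ r ∈ Finset.range Q, ∑ i ∈ Finset.range ((n + (Q - 1 - r)) / Q), u (r + i * Q) := by
  induction n with
  | zero =>
    refine (Finset.sum_eq_zero fun r _ => ?_).symm
    rw [Nat.div_eq_of_lt (by lia), Finset.sum_range_zero]
  | succ n ih =>
    have hdvd : ∀ r < Q, Q ∣ n + (Q - 1 - r) + 1 ↔ n % Q = r := by
      intro r hr
      rw [show n + (Q - 1 - r) + 1 = n + Q - r by lia,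
        ← Nat.modEq_iff_dvd' (by lia), Nat.ModEq, Nat.mod_eq_of_lt hr, Nat.add_mod_right]
      exact eq_comm
    have hindex : (n + (Q - 1 - n % Q)) / Q = n / Q := by
      have hmod := Nat.mod_lt n hQ
      rw [Nat.div_eq_iff hQ]
      have := Nat.div_add_mod' n Q
      lia
    have hstep : ∀ r ∈ Finset.range Q,
        ∑ i ∈ Finset.range ((n + 1 + (Q - 1 - r)) / Q), u (r + i * Q) =
          ∑ i ∈ Finset.range ((n + (Q - 1 - r)) / Q), u (r + i * Q) +
            if n % Q = r then u n else 0 := by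
      intro r hr
      rw [Nat.add_right_comm, Nat.succ_div]
      simp only [hdvd r (Finset.mem_range.1 hr)]
      split_ifs with h
      · rw [Finset.sum_range_succ, ← h, hindex, Nat.mod_add_div']
      · rw [add_zero, add_zero]
    rw [Finset.sum_range_succ, ih, Finset.sum_congr rfl hstep, Finset.sum_add_distrib,
      Finset.sum_ite_eq, if_pos (Finset.mem_range.2 (Nat.mod_lt n hQ))]

theorem tendsto_add_div_div_natCast (k : ℕ) {Q : ℕ} (hQ : 0 < Q) :
    Tendsto (fun n : ℕ => (((n + k) / Q : ℕ) : ℝ) / n) atTop (𝓝 (1 / Q)) := by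
  have hshift : Tendsto (fun n : ℕ => (((n + k : ℕ) : ℝ)) / n) atTop (𝓝 1) := by
    have h := (tendsto_natCast_div_add_atTop (k : ℝ)).inv₀ one_ne_zero
    simpa only [inv_div, inv_one, Nat.cast_add] using h
  have hfloor := (tendsto_nat_floor_mul_div_atTop (R := ℝ) (a := 1 / (Q : ℝ)) (by positivity)).comp
      (tendsto_natCast_atTop_atTop.comp (tendsto_add_atTop_nat k))
  have hmul := hfloor.mul hshift
  rw [mul_one] at hmul
  refine hmul.congr' ?_
  filter_upwards [eventually_gt_atTop 0] with n hn
  simp only [Function.comp_apply]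
  rw [one_div_mul_eq_div, Nat.floor_div_natCast, Nat.floor_natCast]
  have : (0 : ℝ) < (n + k : ℕ) := by positivity
  field_simp

theorem HasCesaroMean.of_residues {c : ℕ → ℝ} {Q : ℕ} (hQ : 0 < Q)
    (h : ∀ r < Q, HasCesaroMean (fun i => u (r + i * Q)) (c r)) :
    HasCesaroMean u ((∑ r ∈ Finset.range Q, c r) / Q) := by
  have hresidue : ∀ r ∈ Finset.range Q, Tendsto (fun n : ℕ =>
      (∑ i ∈ Finset.range ((n + (Q - 1 - r)) / Q), u (r + i * Q)) / (n : ℝ)) atTop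
      (𝓝 (c r * (1 / Q))) := by
    intro r hr
    have hcount : Tendsto (fun n : ℕ => (n + (Q - 1 - r)) / Q) atTop atTop :=
      (Nat.tendsto_div_const_atTop hQ.ne').comp (tendsto_add_atTop_nat _)
    refine (((h r (Finset.mem_range.1 hr)).comp hcount).mul
      (tendsto_add_div_div_natCast (Q - 1 - r) hQ)).congr' ?_
    filter_upwards [hcount.eventually_ne_atTop 0] with n hn
    exact div_mul_div_cancel₀ (Nat.cast_ne_zero.2 hn)
  rw [HasCesaroMean, ← mul_one_div, Finset.sum_mul]
  refine (tendsto_finsetSum _ hresidue).congr fun n => ?_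
  rw [sum_range_eq_sum_residues hQ u, Finset.sum_div]

theorem hasCesaroMean_of_periodic {Q : ℕ} (hQ : 0 < Q) (hu : Function.Periodic u Q) :
    HasCesaroMean u ((∑ r ∈ Finset.range Q, u r) / Q) := by
  refine HasCesaroMean.of_residues hQ fun r _ => ?_
  have hconst : (fun i => u (r + i * Q)) = fun _ => u r := funext fun i => hu.nat_mul i r
  rw [hconst]
  exact hasCesaroMean_const _

end Cesaro

/-! ### Steady-state probabilities -/

theorem comap_indicator_one_le {Ω : Type*} {m : MeasurableSpace Ω} {A : Set Ω}
    (hA : MeasurableSet A) :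
    (inferInstance : MeasurableSpace ℝ).comap (A.indicator (1 : Ω → ℝ)) ≤ m :=
  (measurable_one.indicator hA).comap_le

section Frequency

variable {Ω : Type*} [MeasurableSpace Ω] {μ : Measure Ω}

theorem identDistrib_indicator_one [IsProbabilityMeasure μ] {A B : Set Ω} (hA : MeasurableSet A)
    (hB : MeasurableSet B) (h : μ A = μ B) :
    IdentDistrib (A.indicator (1 : Ω → ℝ)) (B.indicator (1 : Ω → ℝ)) μ μ where
  aemeasurable_fst := (measurable_one.indicator hA).aemeasurable
  aemeasurable_snd := (measurable_one.indicator hB).aemeasurable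
  map_eq := by
    classical
    have hcompl : μ Aᶜ = μ Bᶜ := by rw [prob_compl_eq_one_sub hA, prob_compl_eq_one_sub hB, h]
    ext s hs
    rw [Measure.map_apply (measurable_one.indicator hA) hs,
      Measure.map_apply (measurable_one.indicator hB) hs]
    simp_rw [Pi.one_def, Set.indicator_const_preimage_eq_union]
    split_ifs <;> simp [h, hcompl]

theorem indepFun_indicator_one {A B : Set Ω} (h : IndepSet A B μ) :
    IndepFun (A.indicator (1 : Ω → ℝ)) (B.indicator (1 : Ω → ℝ)) μ := by
  have hle (C : Set Ω) : (inferInstance : MeasurableSpace ℝ).comap (C.indicator (1 : Ω → ℝ)) ≤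
      MeasurableSpace.generateFrom {C} :=
    comap_indicator_one_le (MeasurableSpace.measurableSet_generateFrom rfl)
  exact indep_of_indep_of_le_left
    (indep_of_indep_of_le_right ((IndepSet_iff_Indep _ _ _).1 h) (hle B)) (hle A)

theorem ae_hasCesaroMean_indicator [IsProbabilityMeasure μ] {E : ℕ → Set Ω} {c : ℝ}
    (hE : ∀ i, MeasurableSet (E i)) (hc : ∀ i, μ.real (E i) = c)
    (hindep : Pairwise fun i j => IndepSet (E i) (E j) μ) :
    ∀ᵐ ω ∂μ, HasCesaroMean (fun i => (E i).indicator (1 : Ω → ℝ) ω) c := by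
  have hlaw := strong_law_ae_real (μ := μ) (fun i => (E i).indicator (1 : Ω → ℝ))
    ((integrable_const (1 : ℝ)).indicator (hE 0))
    (fun i j hij => indepFun_indicator_one (hindep hij))
    (fun i => identDistrib_indicator_one (hE i) (hE 0) <|
      (ENNReal.toReal_eq_toReal_iff' (measure_ne_top _ _) (measure_ne_top _ _)).1
        ((hc i).trans (hc 0).symm))
  rwa [integral_indicator_one (hE 0), hc 0] at hlaw

/- Along each residue class modulo a multiple of the period that exceeds the range of dependence,
the events are independent and equally likely. -/
theorem ae_hasCesaroMean_indicator_of_periodic [IsProbabilityMeasure μ] {E : ℕ → Set Ω}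
    {p : ℕ → ℝ} {T L : ℕ} (hT : 0 < T) (hE : ∀ t, MeasurableSet (E t))
    (hp : Function.Periodic p T) (hEp : ∀ t, μ.real (E t) = p t)
    (hindep : ∀ t t', t + L ≤ t' → IndepSet (E t) (E t') μ) :
    ∀ᵐ ω ∂μ, HasCesaroMean (fun t => (E t).indicator (1 : Ω → ℝ) ω)
      ((∑ s ∈ Finset.range T, p s) / T) := by
  set Q := (L + 1) * T
  have hQ : 0 < Q := by positivity
  have hLQ : L ≤ Q := L.le_succ.trans (Nat.le_mul_of_pos_right _ hT)
  have hpQ : Function.Periodic p Q := by simpa using hp.nat_mul (L + 1)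
  have hmean : (∑ r ∈ Finset.range Q, p r) / Q = (∑ s ∈ Finset.range T, p s) / T :=
    (hasCesaroMean_of_periodic hQ hpQ).unique (hasCesaroMean_of_periodic hT hp)
  have hresidue : ∀ r, ∀ᵐ ω ∂μ,
      HasCesaroMean (fun i => (E (r + i * Q)).indicator (1 : Ω → ℝ) ω) (p r) := by
    intro r
    have hlt : ∀ i j, i < j → IndepSet (E (r + i * Q)) (E (r + j * Q)) μ := by
      intro i j hij
      have : (i + 1) * Q ≤ j * Q := Nat.mul_le_mul_right Q hij
      exact hindep _ _ (by lia)
    exact ae_hasCesaroMean_indicator (fun i => hE _)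
      (fun i => (hEp _).trans (hpQ.nat_mul i r))
      fun i j hij => hij.lt_or_gt.elim (hlt i j) fun hji => (hlt j i hji).symm
  filter_upwards [ae_all_iff.2 hresidue] with ω hω
  exact hmean ▸ HasCesaroMean.of_residues hQ fun r _ => hω r

end Frequency

section SteadyState

variable {Ω : Type*} [MeasurableSpace Ω] {μ : Measure Ω} {E F : ℕ → Set Ω} {c : ℝ}

theorem isSteadyStateProb_iff : IsSteadyStateProb μ E c ↔
    HasCesaroMean (fun t => μ.real (E t)) c ∧
      ∀ᵐ ω ∂μ, HasCesaroMean (fun t => (E t).indicator (1 : Ω → ℝ) ω) c := by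
  classical
  simp only [IsSteadyStateProb, HasCesaroMean, Finset.natCast_card_filter, Set.indicator_apply,
    Pi.one_apply]

theorem IsSteadyStateProb.congr (h : IsSteadyStateProb μ E c) (hEF : ∀ᶠ t in atTop, E t = F t) :
    IsSteadyStateProb μ F c := by
  rw [isSteadyStateProb_iff] at h ⊢
  refine ⟨(hasCesaroMean_congr ?_).1 h.1, h.2.mono fun ω hω => (hasCesaroMean_congr ?_).1 hω⟩ <;>
    exact hEF.mono fun t ht => by simp only [ht]

theorem IsSteadyStateProb.compl [IsProbabilityMeasure μ] (h : IsSteadyStateProb μ E c)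
    (hE : ∀ t, MeasurableSet (E t)) : IsSteadyStateProb μ (fun t => (E t)ᶜ) (1 - c) := by
  rw [isSteadyStateProb_iff] at h ⊢
  refine ⟨?_, h.2.mono fun ω hω => ?_⟩
  · simpa only [probReal_compl_eq_one_sub (hE _)] using (hasCesaroMean_const 1).sub h.1
  · simpa only [Set.indicator_compl, Pi.sub_apply, Pi.one_apply] using
      (hasCesaroMean_const 1).sub hω

theorem isSteadyStateProb_of_periodic [IsProbabilityMeasure μ] {p : ℕ → ℝ} {T L t₀ : ℕ}
    (hT : 0 < T) (hE : ∀ t, MeasurableSet (E t)) (hp : Function.Periodic p T)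
    (hEp : ∀ t, t₀ ≤ t → μ.real (E t) = p t)
    (hindep : ∀ t t', t + L ≤ t' → IndepSet (E t) (E t') μ) :
    IsSteadyStateProb μ E ((∑ s ∈ Finset.range T, p s) / T) := by
  refine isSteadyStateProb_iff.2 ⟨?_, ?_⟩
  · refine (hasCesaroMean_congr ?_).1 (hasCesaroMean_of_periodic hT hp)
    filter_upwards [eventually_ge_atTop t₀] with t ht using (hEp t ht).symm
  · have hk : t₀ ≤ t₀ * T := Nat.le_mul_of_pos_right t₀ hT
    have hshift := ae_hasCesaroMean_indicator_of_periodic (E := fun t => E (t₀ * T + t)) (L := L)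
      hT (fun t => hE _) hp
      (fun t => (hEp _ (by lia)).trans (by rw [add_comm]; exact hp.nat_mul t₀ t))
      (fun t t' htt' => hindep _ _ (by lia))
    exact hshift.mono fun ω hω => HasCesaroMean.of_shift (t₀ * T) hω

end SteadyState

/-! ### Survival products -/

section Survival

variable {D : ℕ → ℝ} {T κ : ℕ}

/-- Probability that no data of age less than `κ` is available at a slot congruent to `s` modulo the
round length `T`, if data of age `d` has been delivered with probability `D d`. The slot must not
be earlier than `κ - 1`, since all rounds that could deliver such data must exist. -/
noncomputable def survival (D : ℕ → ℝ) (T κ s : ℕ) : ℝ :=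
  ∏ d ∈ Finset.range κ with d ≡ s [MOD T], (1 - D d)

theorem survival_congr {s s' : ℕ} (h : s ≡ s' [MOD T]) :
    survival D T κ s = survival D T κ s' := by
  unfold survival
  congr 1
  exact Finset.filter_congr fun d _ => ⟨fun hd => hd.trans h, fun hd => hd.trans h.symm⟩

theorem survival_periodic : Function.Periodic (survival D T κ) T := fun s =>
  survival_congr (Nat.add_mod_right s T)

theorem survival_succ (κ s : ℕ) : survival D T (κ + 1) s =
    survival D T κ s - if κ ≡ s [MOD T] then D κ * survival D T κ κ else 0 := by
  rw [survival, Finset.range_add_one, Finset.filter_insert]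
  split_ifs with h
  · rw [Finset.prod_insert (by simp), ← survival, survival_congr h]
    ring
  · rw [sub_zero, survival]

theorem sum_survival (hT : 0 < T) (κ : ℕ) : ∑ s ∈ Finset.range T, survival D T κ s =
    T - ∑ a ∈ Finset.range κ, D a * survival D T a a := by
  induction κ with
  | zero => simp [survival]
  | succ κ ih =>
    have hresidue : ∀ s ∈ Finset.range T, κ ≡ s [MOD T] ↔ κ % T = s := fun s hs => by
      rw [Nat.ModEq, Nat.mod_eq_of_lt (Finset.mem_range.1 hs)]
    simp_rw [survival_succ, Finset.sum_sub_distrib]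
    rw [ih, Finset.sum_range_succ,
      Finset.sum_congr rfl fun s hs => if_congr (hresidue s hs) rfl rfl, Finset.sum_ite_eq,
      if_pos (Finset.mem_range.2 (Nat.mod_lt κ hT)), sub_sub]

theorem survival_nonneg (hD : ∀ d, D d ≤ 1) (κ s : ℕ) : 0 ≤ survival D T κ s :=
  Finset.prod_nonneg fun d _ => sub_nonneg.2 (hD d)

theorem survival_le_one (hD0 : ∀ d, 0 ≤ D d) (hD : ∀ d, D d ≤ 1) (κ s : ℕ) :
    survival D T κ s ≤ 1 :=
  Finset.prod_le_one (fun d _ => sub_nonneg.2 (hD d)) fun d _ => sub_le_self _ (hD0 d)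

theorem survival_add_period {d s : ℕ} (hκd : κ ≤ d) (hdκ : d < κ + T) (h : d ≡ s [MOD T]) :
    survival D T (κ + T) s = survival D T κ s * (1 - D d) := by
  have hunique : ∀ e ∈ Finset.range T, κ + e ≡ s [MOD T] ↔ e = d - κ := by
    intro e he
    rw [Finset.mem_range] at he
    constructor
    · intro hes
      have hed : κ + e ≡ κ + (d - κ) [MOD T] := by
        rw [Nat.add_sub_cancel' hκd]
        exact hes.trans h.symm
      exact (Nat.ModEq.add_left_cancel' κ hed).eq_of_lt_of_lt he (by lia)
    · rintro rfl
      rwa [Nat.add_sub_cancel' hκd]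
  simp only [survival, Finset.prod_filter]
  rw [Finset.prod_range_add,
    Finset.prod_congr rfl fun e he => if_congr (hunique e he) rfl rfl, Finset.prod_ite_eq',
    if_pos (Finset.mem_range.2 (by lia)), Nat.add_sub_cancel' hκd]

section Eventually

variable {p : ℝ} (hD0 : ∀ d, 0 ≤ D d) (hD : ∀ d, D d ≤ 1) (hp : ∀ d, T ≤ d → D d = p)
include hD0 hD hp

theorem survival_mul_period_le {s : ℕ} (hs : s < T) (M : ℕ) :
    survival D T ((M + 1) * T) s ≤ (1 - p) ^ M := by
  induction M with
  | zero => exact (survival_le_one hD0 hD _ _).trans_eq (pow_zero _).symm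
  | succ M ih =>
    have hp1 : p ≤ 1 := hp T le_rfl ▸ hD T
    rw [Nat.succ_mul, survival_add_period (d := (M + 1) * T + s) (by lia) (by lia)
      (by simp [Nat.ModEq]), hp _ (by nlinarith), pow_succ]
    exact mul_le_mul_of_nonneg_right ih (by linarith)

theorem tendsto_survival_mul_period (hp0 : 0 < p) {s : ℕ} (hs : s < T) :
    Tendsto (fun M : ℕ => survival D T ((M + 1) * T) s) atTop (𝓝 0) := by
  have hp1 : p ≤ 1 := hp T le_rfl ▸ hD T
  exact squeeze_zero (fun M => survival_nonneg hD _ _)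
    (survival_mul_period_le hD0 hD hp hs)
    (tendsto_pow_atTop_nhds_zero_of_lt_one (by linarith) (by linarith))

theorem hasSum_mul_survival (hT : 0 < T) (hp0 : 0 < p) :
    HasSum (fun a => D a * survival D T a a) T := by
  have hnonneg : ∀ a, 0 ≤ D a * survival D T a a := fun a =>
    mul_nonneg (hD0 a) (survival_nonneg hD _ _)
  have hmono : Monotone fun n => ∑ a ∈ Finset.range n, D a * survival D T a a :=
    monotone_nat_of_le_succ fun n => by
      rw [Finset.sum_range_succ]
      linarith [hnonneg n]
  have hperiods : Tendsto (fun M : ℕ => (M + 1) * T) atTop atTop :=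
    (tendsto_add_atTop_nat 1).atTop_mul_const' hT
  rw [hasSum_iff_tendsto_nat_of_nonneg hnonneg,
    tendsto_iff_tendsto_subseq_of_monotone hmono hperiods]
  have hlimit := (tendsto_const_nhds (x := (T : ℝ))).sub (tendsto_finsetSum (Finset.range T)
    fun s hs => tendsto_survival_mul_period hD0 hD hp hp0 (Finset.mem_range.1 hs))
  rw [Finset.sum_const_zero, sub_zero] at hlimit
  exact hlimit.congr fun M => by rw [sum_survival hT, sub_sub_cancel]; rfl

end Eventually

end Survival

/-! ### Lag sequences -/

section Lag

variable {Ω : Type*}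

/-- The lags with which rounds of length `T` deliver their data, counted from the start of the
round: an independent, identically distributed sequence of times at most `T`, where the lag `0`
encodes a round without delivery, and `D d` is the probability of a delivery within time `d`. -/
structure IsLagSequence [MeasurableSpace Ω] (μ : Measure Ω) (lag : ℕ → Ω → ℕ) (T : ℕ)
    (D : ℕ → ℝ) : Prop where
  pos : 0 < T
  measurable : ∀ j, Measurable (lag j)
  indep : iIndepFun lag μ
  prob : ∀ j d, μ.real {ω | lag j ω ∈ Set.Icc 1 d} = D d
  lag_le : ∀ j ω, lag j ω ≤ T
  prob_pos : 0 < D T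

/-- The rounds whose data would have age less than `κ` at time `t`. -/
def ageWindow (T t κ : ℕ) : Finset ℕ :=
  (Finset.range (t + 1)).filter fun j => j * T ≤ t ∧ t < j * T + κ

/-- The event that no data of age less than `κ` is available at time `t`. -/
def staleSet (lag : ℕ → Ω → ℕ) (T t κ : ℕ) : Set Ω :=
  {ω | ∀ j ∈ ageWindow T t κ, lag j ω ∉ Set.Icc 1 (t - j * T)}

/-- The σ-algebra generated by the lags of the rounds in `S`. -/
abbrev lagAlgebra (lag : ℕ → Ω → ℕ) (S : Set ℕ) : MeasurableSpace Ω :=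
  ⨆ j ∈ S, MeasurableSpace.comap (lag j) inferInstance

variable {lag : ℕ → Ω → ℕ} {T t κ : ℕ} {D : ℕ → ℝ} {S : Set ℕ}

theorem mem_ageWindow (hT : 0 < T) {j : ℕ} :
    j ∈ ageWindow T t κ ↔ j * T ≤ t ∧ t < j * T + κ := by
  rw [ageWindow, Finset.mem_filter, Finset.mem_range, and_iff_right_iff_imp]
  rintro ⟨h, -⟩
  nlinarith

theorem ageWindow_subset_Ioi (hT : 0 < T) (i a : ℕ) :
    (ageWindow T (i * T + a) a : Set ℕ) ⊆ Set.Ioi i := fun j hj => by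
  rw [Finset.mem_coe, mem_ageWindow hT] at hj
  exact lt_of_mul_lt_mul_right (by lia : i * T < j * T) (Nat.zero_le T)

theorem prod_ageWindow (hT : 0 < T) (hκ : κ ≤ t + 1) (f : ℕ → ℝ) :
    ∏ j ∈ ageWindow T t κ, f (t - j * T) = ∏ d ∈ Finset.range κ with d ≡ t [MOD T], f d := by
  refine Finset.prod_nbij (fun j => t - j * T) (fun j hj => ?_) (fun i hi j hj hij => ?_)
    (fun d hd => ?_) fun _ _ => rfl
  · rw [mem_ageWindow hT] at hj
    rw [Finset.mem_filter, Finset.mem_range]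
    exact ⟨by lia, (Nat.modEq_iff_dvd' (t.sub_le _)).2
      ⟨j, by rw [Nat.sub_sub_self hj.1, mul_comm]⟩⟩
  · rw [Finset.mem_coe, mem_ageWindow hT] at hi hj
    exact Nat.eq_of_mul_eq_mul_right hT (by simp only at hij; lia)
  · rw [Finset.mem_coe, Finset.mem_filter, Finset.mem_range] at hd
    obtain ⟨j, hj⟩ := (Nat.modEq_iff_dvd' (by lia)).1 hd.2
    rw [mul_comm] at hj
    exact ⟨j, Finset.mem_coe.2 ((mem_ageWindow hT).2 (by lia)), by simp only; lia⟩

theorem staleSet_eq_biInter : staleSet lag T t κ =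
    ⋂ j ∈ ageWindow T t κ, lag j ⁻¹' (Set.Icc 1 (t - j * T))ᶜ := by
  ext
  simp [staleSet]

theorem measurableSet_lagAlgebra_preimage {j : ℕ} (hj : j ∈ S) (A : Set ℕ) :
    MeasurableSet[lagAlgebra lag S] (lag j ⁻¹' A) :=
  le_biSup (fun j => MeasurableSpace.comap (lag j) inferInstance) hj _
    ⟨A, A.to_countable.measurableSet, rfl⟩

theorem measurableSet_lagAlgebra_staleSet (h : ↑(ageWindow T t κ) ⊆ S) :
    MeasurableSet[lagAlgebra lag S] (staleSet lag T t κ) := by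
  rw [staleSet_eq_biInter]
  exact Finset.measurableSet_biInter _ fun j hj => measurableSet_lagAlgebra_preimage (h hj) _

namespace IsLagSequence

variable [mΩ : MeasurableSpace Ω] {μ : Measure Ω} (h : IsLagSequence μ lag T D)
include h

theorem isProbabilityMeasure : IsProbabilityMeasure μ := h.indep.isProbabilityMeasure

theorem lagAlgebra_le (S : Set ℕ) : lagAlgebra lag S ≤ mΩ :=
  iSup₂_le fun j _ => (h.measurable j).comap_le

theorem indep_lagAlgebra {S' : Set ℕ} (hS : Disjoint S S') :
    Indep (lagAlgebra lag S) (lagAlgebra lag S') μ :=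
  indep_iSup_of_disjoint (fun j => (h.measurable j).comap_le) h.indep.iIndep hS

theorem measurableSet_staleSet (t κ : ℕ) : MeasurableSet (staleSet lag T t κ) :=
  h.lagAlgebra_le _ _ (measurableSet_lagAlgebra_staleSet (Set.subset_univ _))

theorem prob_nonneg (d : ℕ) : 0 ≤ D d := h.prob 0 d ▸ measureReal_nonneg

theorem prob_le_one (d : ℕ) : D d ≤ 1 :=
  have := h.isProbabilityMeasure
  h.prob 0 d ▸ measureReal_le_one

theorem prob_eq_of_le {d : ℕ} (hd : T ≤ d) : D d = D T := by
  rw [← h.prob 0 d, ← h.prob 0 T]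
  congr 1
  ext ω
  have := h.lag_le 0 ω
  simp only [Set.mem_Icc, Set.mem_ofPred_eq]
  lia

theorem measureReal_staleSet (hκ : κ ≤ t + 1) :
    μ.real (staleSet lag T t κ) = survival D T κ t := by
  have := h.isProbabilityMeasure
  have hmiss : ∀ j d, (μ (lag j ⁻¹' (Set.Icc 1 d)ᶜ)).toReal = 1 - D d := fun j d => by
    rw [Set.preimage_compl, ← measureReal_def,
      probReal_compl_eq_one_sub (h.measurable j measurableSet_Icc), ← h.prob j d]
    rfl
  rw [staleSet_eq_biInter, measureReal_def, h.indep.measure_inter_preimage_eq_mul _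
    (fun j _ => (Set.to_countable _).measurableSet), ENNReal.toReal_prod]
  simp_rw [hmiss]
  exact prod_ageWindow h.pos hκ fun d => 1 - D d

theorem indepSet_staleSet {t t' : ℕ} (ht : t + κ ≤ t') :
    IndepSet (staleSet lag T t κ) (staleSet lag T t' κ) μ := by
  have := h.isProbabilityMeasure
  have hdisj : Disjoint (ageWindow T t κ : Set ℕ) (ageWindow T t' κ) := by
    rw [Set.disjoint_left]
    intro j hj hj'
    rw [Finset.mem_coe, mem_ageWindow h.pos] at hj hj'
    lia
  exact (h.indep_lagAlgebra hdisj).indepSet_of_measurableSet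
    (measurableSet_lagAlgebra_staleSet subset_rfl) (measurableSet_lagAlgebra_staleSet subset_rfl)

theorem isSteadyStateProb_staleSet (κ : ℕ) :
    IsSteadyStateProb μ (fun t => staleSet lag T t κ)
      ((∑ s ∈ Finset.range T, survival D T κ s) / T) := by
  have := h.isProbabilityMeasure
  exact isSteadyStateProb_of_periodic (t₀ := κ) h.pos (fun t => h.measurableSet_staleSet t κ)
    survival_periodic (fun t ht => h.measureReal_staleSet (by lia))
    fun t t' ht => h.indepSet_staleSet ht

end IsLagSequence

end Lag

/-! ### Renewal cycles -/

section Renewal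

variable {Ω : Type*} {lag : ℕ → Ω → ℕ} {T : ℕ} {D : ℕ → ℝ}

/-- The `k`-th delivering round. -/
noncomputable def deliveryRound (lag : ℕ → Ω → ℕ) (k : ℕ) (ω : Ω) : ℕ :=
  Nat.nth (fun j => lag j ω ≠ 0) k

/-- Time from the start of the `k`-th delivering round to the next delivery, which is the first age
that the data of this round does not reach. -/
noncomputable def peakAge (lag : ℕ → Ω → ℕ) (T k : ℕ) (ω : Ω) : ℕ :=
  (deliveryRound lag (k + 1) ω - deliveryRound lag k ω) * T + lag (deliveryRound lag (k + 1) ω) ω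

/-- Number of slots from the `k`-th to the next delivery in which the age is at least `κ`. -/
noncomputable def violationTime (lag : ℕ → Ω → ℕ) (T k κ : ℕ) (ω : Ω) : ℕ :=
  peakAge lag T k ω - max (lag (deliveryRound lag k ω) ω) κ

/-- The event that exactly `k` of the first `i` rounds deliver. -/
def countSet (lag : ℕ → Ω → ℕ) (i k : ℕ) : Set Ω :=
  {ω | Nat.count (fun j => lag j ω ≠ 0) i = k}

/-- The event that the `k`-th delivering round provides the most recent available data when these
data have age `a`. It is decomposed according to the number `i` of this round. -/
def currentSet (lag : ℕ → Ω → ℕ) (T k a : ℕ) : Set Ω :=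
  ⋃ i, countSet lag i k ∩ (lag i ⁻¹' Set.Icc 1 a ∩ staleSet lag T (i * T + a) a)

section Pointwise

variable {ω : Ω} (hinf : {j | lag j ω ≠ 0}.Infinite)
include hinf

theorem deliveryRound_lt_succ (k : ℕ) : deliveryRound lag k ω < deliveryRound lag (k + 1) ω :=
  Nat.nth_strictMono hinf k.lt_succ_self

theorem lag_deliveryRound_ne_zero (k : ℕ) : lag (deliveryRound lag k ω) ω ≠ 0 :=
  Nat.nth_mem_of_infinite hinf k

theorem deliveryRound_mul_add_peakAge (T k : ℕ) : deliveryRound lag k ω * T + peakAge lag T k ω =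
    deliveryRound lag (k + 1) ω * T + lag (deliveryRound lag (k + 1) ω) ω := by
  rw [peakAge, ← add_assoc, ← add_mul, Nat.add_sub_cancel' (deliveryRound_lt_succ hinf k).le]

theorem lag_deliveryRound_le_peakAge (hle : ∀ j, lag j ω ≤ T) (k : ℕ) :
    lag (deliveryRound lag k ω) ω ≤ peakAge lag T k ω := by
  have := Nat.mul_le_mul_right T (deliveryRound_lt_succ hinf k)
  have := deliveryRound_mul_add_peakAge hinf T k
  have := hle (deliveryRound lag k ω)
  lia

theorem mem_countSet_inter_iff {i k : ℕ} :
    ω ∈ countSet lag i k ∩ lag i ⁻¹' {0}ᶜ ↔ i = deliveryRound lag k ω := by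
  constructor
  · rintro ⟨rfl, hi⟩
    exact (Nat.nth_count (p := fun j => lag j ω ≠ 0) hi).symm
  · rintro rfl
    exact ⟨Nat.count_nth_of_infinite hinf k, lag_deliveryRound_ne_zero hinf k⟩

theorem mem_staleSet_deliveryRound_iff (hT : 0 < T) (hle : ∀ j, lag j ω ≤ T) {k a : ℕ} :
    ω ∈ staleSet lag T (deliveryRound lag k ω * T + a) a ↔ a < peakAge lag T k ω := by
  have hpeak := deliveryRound_mul_add_peakAge hinf T k
  have hlt := deliveryRound_lt_succ hinf k
  have hpos := Nat.one_le_iff_ne_zero.2 (lag_deliveryRound_ne_zero hinf (k + 1))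
  have hnext : ∀ j, lag j ω ≠ 0 → j < deliveryRound lag (k + 1) ω → j ≤ deliveryRound lag k ω :=
    fun j hj hjk => Nat.le_nth_of_lt_nth_succ (p := fun j => lag j ω ≠ 0) hjk hj
  set i := deliveryRound lag k ω
  set i' := deliveryRound lag (k + 1) ω
  constructor
  · intro hstale
    by_contra! hle_age
    have := Nat.mul_lt_mul_of_pos_right hlt hT
    exact hstale i' ((mem_ageWindow hT).2 ⟨by lia, by lia⟩) ⟨hpos, by lia⟩
  · rintro hlt_peak j hj ⟨hj_pos, hj_le⟩
    rw [mem_ageWindow hT] at hj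
    have hij : i < j := lt_of_mul_lt_mul_right (by lia : i * T < j * T) (Nat.zero_le T)
    have hi'j : i' ≤ j := by
      by_contra! hji'
      exact (hnext j (Nat.one_le_iff_ne_zero.1 hj_pos) hji').not_gt hij
    rcases hi'j.eq_or_lt with rfl | hi'j
    · lia
    · have := Nat.mul_le_mul_right T (Nat.succ_le_of_lt hi'j)
      rw [Nat.succ_mul] at this
      have := hle i'
      lia

theorem mem_currentSet_iff (hT : 0 < T) (hle : ∀ j, lag j ω ≤ T) {k a : ℕ} :
    ω ∈ currentSet lag T k a ↔
      lag (deliveryRound lag k ω) ω ≤ a ∧ a < peakAge lag T k ω := by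
  rw [currentSet, Set.mem_iUnion, ← mem_staleSet_deliveryRound_iff hinf hT hle]
  constructor
  · rintro ⟨i, hcount, hlag, hstale⟩
    obtain rfl : i = deliveryRound lag k ω := (mem_countSet_inter_iff hinf).1
      ⟨hcount, (Nat.one_le_iff_ne_zero.1 hlag.1 : lag i ω ≠ 0)⟩
    exact ⟨hlag.2, hstale⟩
  · rintro ⟨hlag, hstale⟩
    exact ⟨_, ((mem_countSet_inter_iff hinf).2 rfl).1,
      ⟨Nat.one_le_iff_ne_zero.2 (lag_deliveryRound_ne_zero hinf k), hlag⟩, hstale⟩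

theorem tsum_indicator_currentSet (hT : 0 < T) (hle : ∀ j, lag j ω ≤ T) (k κ : ℕ) :
    ∑' a, (currentSet lag T k (a + κ)).indicator (1 : Ω → ENNReal) ω =
      (violationTime lag T k κ ω : ENNReal) := by
  classical
  set z := lag (deliveryRound lag k ω) ω with hz
  set w := peakAge lag T k ω with hw
  have hind : ∀ a, (currentSet lag T k (a + κ)).indicator (1 : Ω → ENNReal) ω =
      if a ∈ Finset.Ico (z - κ) (w - κ) then 1 else 0 := fun a => by
    rw [Set.indicator_apply]
    refine if_congr ?_ rfl rfl
    rw [mem_currentSet_iff hinf hT hle, Finset.mem_Ico]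
    lia
  have hcard : w - κ - (z - κ) = violationTime lag T k κ ω := by
    rw [violationTime, ← hz, ← hw]
    lia
  simp_rw [hind]
  rw [tsum_eq_sum (s := Finset.Ico (z - κ) (w - κ)) fun a ha => if_neg ha,
    Finset.sum_congr rfl fun a ha => if_pos ha, Finset.sum_const, Nat.card_Ico, nsmul_one, hcard]

end Pointwise

theorem pairwise_disjoint_countSet (k : ℕ) :
    Pairwise fun i j => Disjoint (countSet lag i k ∩ lag i ⁻¹' {0}ᶜ)
      (countSet lag j k ∩ lag j ⁻¹' {0}ᶜ) := by
  have hlt : ∀ i j, i < j → Disjoint (countSet lag i k ∩ lag i ⁻¹' {0}ᶜ)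
      (countSet lag j k ∩ lag j ⁻¹' {0}ᶜ) := fun i j hij => by
    rw [Set.disjoint_left]
    rintro ω ⟨hi : Nat.count _ i = k, hi' : lag i ω ≠ 0⟩ ⟨hj : Nat.count _ j = k, -⟩
    have hcount := Nat.count_monotone (fun j => lag j ω ≠ 0) (Nat.succ_le_of_lt hij)
    rw [Nat.succ_eq_add_one, Nat.count_succ, if_pos hi'] at hcount
    lia
  exact fun i j hij => hij.lt_or_gt.elim (hlt i j) fun hji => (hlt j i hji).symm

theorem measurableSet_lagAlgebra_countSet (i k : ℕ) :
    MeasurableSet[lagAlgebra lag (Set.Iio i)] (countSet lag i k) := by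
  have hcount : ∀ n ≤ i, Measurable[lagAlgebra lag (Set.Iio i)]
      fun ω => Nat.count (fun j => lag j ω ≠ 0) n := by
    intro n
    induction n with
    | zero =>
      intro _
      simp only [Nat.count_zero]
      exact measurable_const
    | succ n ih =>
      intro hn
      simp only [Nat.count_succ]
      exact (ih (by lia)).add (Measurable.ite
        (measurableSet_lagAlgebra_preimage (Set.mem_Iio.2 (by lia)) {0}ᶜ)
        measurable_const measurable_const)
  exact hcount i le_rfl (measurableSet_singleton k)

namespace IsLagSequence

variable [mΩ : MeasurableSpace Ω] {μ : Measure Ω} (h : IsLagSequence μ lag T D)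
include h

theorem measurableSet_preimage (j : ℕ) (A : Set ℕ) : MeasurableSet (lag j ⁻¹' A) :=
  h.measurable j A.to_countable.measurableSet

theorem measurableSet_countSet (i k : ℕ) : MeasurableSet (countSet lag i k) :=
  h.lagAlgebra_le _ _ (measurableSet_lagAlgebra_countSet i k)

theorem measurableSet_currentSet (k a : ℕ) : MeasurableSet (currentSet lag T k a) :=
  .iUnion fun i => (h.measurableSet_countSet i k).inter
    ((h.measurableSet_preimage i _).inter (h.measurableSet_staleSet _ _))

theorem measure_Icc (j d : ℕ) : μ (lag j ⁻¹' Set.Icc 1 d) = ENNReal.ofReal (D d) := by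
  have := h.isProbabilityMeasure
  rw [← h.prob j d, ofReal_measureReal]
  rfl

theorem measure_ne_zero (j : ℕ) : μ (lag j ⁻¹' {0}ᶜ) = ENNReal.ofReal (D T) := by
  rw [← h.measure_Icc j T]
  congr 1
  ext ω
  have := h.lag_le j ω
  simp only [Set.mem_preimage, Set.mem_Icc, Set.mem_compl_iff, Set.mem_singleton_iff]
  lia

theorem ae_infinite : ∀ᵐ ω ∂μ, {j | lag j ω ≠ 0}.Infinite := by
  have := h.isProbabilityMeasure
  have hmeas : ∀ j, MeasurableSet (lag j ⁻¹' {0}ᶜ) := fun j => h.measurableSet_preimage j _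
  have hindep : iIndepSet (fun j => lag j ⁻¹' {0}ᶜ) μ :=
    (iIndepSet_iff_meas_biInter hmeas).2 fun s =>
      h.indep.measure_inter_preimage_eq_mul s (sets := fun _ => {0}ᶜ)
        fun _ _ => (measurableSet_singleton 0).compl
  have hborel_cantelli := measure_limsup_eq_one hmeas hindep (by
    simp_rw [h.measure_ne_zero]
    exact ENNReal.tsum_const_eq_top_of_ne_zero (ENNReal.ofReal_pos.2 h.prob_pos).ne')
  filter_upwards [(mem_ae_iff_prob_eq_one (MeasurableSet.measurableSet_limsup hmeas)).2
    hborel_cantelli] with ω hω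
  exact Nat.frequently_atTop_iff_infinite.1 (mem_limsup_iff_frequently_mem.1 hω)

theorem measure_countSet_inter {A : Set Ω} {i : ℕ} (k : ℕ)
    (hA : MeasurableSet[lagAlgebra lag (Set.Ici i)] A) :
    μ (countSet lag i k ∩ A) = μ (countSet lag i k) * μ A :=
  (Indep_iff _ _ μ).1 (h.indep_lagAlgebra (Set.Iio_disjoint_Ici le_rfl)) _ _
    (measurableSet_lagAlgebra_countSet i k) hA

theorem tsum_measure_countSet (k : ℕ) :
    (∑' i, μ (countSet lag i k)) * ENNReal.ofReal (D T) = 1 := by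
  have := h.isProbabilityMeasure
  have hsplit : ∀ i, μ (countSet lag i k) * ENNReal.ofReal (D T) =
      μ (countSet lag i k ∩ lag i ⁻¹' {0}ᶜ) := fun i => by
    rw [h.measure_countSet_inter k (measurableSet_lagAlgebra_preimage Set.self_mem_Ici _),
      h.measure_ne_zero]
  rw [← ENNReal.tsum_mul_right, tsum_congr hsplit, ← measure_iUnion (pairwise_disjoint_countSet k)
    fun i => (h.measurableSet_countSet i k).inter (h.measurableSet_preimage i _),
    ← measure_univ (μ := μ)]
  refine measure_congr (eventuallyEq_univ.2 ?_)
  filter_upwards [h.ae_infinite] with ω hω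
  exact Set.mem_iUnion.2 ⟨_, (mem_countSet_inter_iff hω).2 rfl⟩

theorem measure_Icc_inter_staleSet (i a : ℕ) :
    μ (lag i ⁻¹' Set.Icc 1 a ∩ staleSet lag T (i * T + a) a) =
      ENNReal.ofReal (D a * survival D T a a) := by
  have := h.isProbabilityMeasure
  have hresidue : i * T + a ≡ a [MOD T] := by simp [Nat.ModEq]
  rw [(Indep_iff _ _ μ).1 (h.indep_lagAlgebra (S := {i}) (S' := Set.Ioi i) (by simp)) _ _
      (measurableSet_lagAlgebra_preimage (Set.mem_singleton i) _)
      (measurableSet_lagAlgebra_staleSet (ageWindow_subset_Ioi h.pos i a)),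
    h.measure_Icc, ← ofReal_measureReal (μ := μ) (s := staleSet lag T (i * T + a) a),
    h.measureReal_staleSet (by lia), survival_congr hresidue,
    ← ENNReal.ofReal_mul (h.prob_nonneg a)]

theorem measure_currentSet (k a : ℕ) :
    μ (currentSet lag T k a) = ENNReal.ofReal (D a * survival D T a a / D T) := by
  have hdisj : Pairwise fun i j => Disjoint
      (countSet lag i k ∩ (lag i ⁻¹' Set.Icc 1 a ∩ staleSet lag T (i * T + a) a))
      (countSet lag j k ∩ (lag j ⁻¹' Set.Icc 1 a ∩ staleSet lag T (j * T + a) a)) := by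
    refine fun i j hij => (pairwise_disjoint_countSet (lag := lag) k hij).mono ?_ ?_ <;>
      exact Set.inter_subset_inter_right _ fun ω hω => Nat.one_le_iff_ne_zero.1 hω.1.1
  have hfactor : ∀ i, μ (countSet lag i k ∩
      (lag i ⁻¹' Set.Icc 1 a ∩ staleSet lag T (i * T + a) a)) =
      μ (countSet lag i k) * ENNReal.ofReal (D a * survival D T a a) := fun i => by
    have hwindow : (ageWindow T (i * T + a) a : Set ℕ) ⊆ Set.Ici i :=
      (ageWindow_subset_Ioi h.pos i a).trans Set.Ioi_subset_Ici_self
    rw [h.measure_countSet_inter k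
      (MeasurableSet.inter (measurableSet_lagAlgebra_preimage Set.self_mem_Ici _)
        (measurableSet_lagAlgebra_staleSet hwindow)), h.measure_Icc_inter_staleSet]
  rw [currentSet, measure_iUnion hdisj fun i => (h.measurableSet_countSet i k).inter
      ((h.measurableSet_preimage i _).inter (h.measurableSet_staleSet _ _)),
    tsum_congr hfactor, ENNReal.tsum_mul_right, ENNReal.ofReal_div_of_pos h.prob_pos,
    ENNReal.eq_div_iff (ENNReal.ofReal_pos.2 h.prob_pos).ne' ENNReal.ofReal_ne_top, ← mul_assoc,
    mul_comm (ENNReal.ofReal (D T)), h.tsum_measure_countSet, one_mul]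

theorem violationTime_ae_eq_tsum (k κ : ℕ) :
    (fun ω => (violationTime lag T k κ ω : ENNReal)) =ᵐ[μ]
      fun ω => ∑' a, (currentSet lag T k (a + κ)).indicator (1 : Ω → ENNReal) ω := by
  filter_upwards [h.ae_infinite] with ω hω
  exact (tsum_indicator_currentSet hω h.pos (fun j => h.lag_le j ω) k κ).symm

theorem aemeasurable_violationTime (k κ : ℕ) :
    AEMeasurable (fun ω => (violationTime lag T k κ ω : ENNReal)) μ :=
  (Measurable.tsum fun a => measurable_one.indicator
    (h.measurableSet_currentSet k (a + κ))).aemeasurable.congr (h.violationTime_ae_eq_tsum k κ).symm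

theorem lintegral_violationTime (k κ : ℕ) :
    ∫⁻ ω, (violationTime lag T k κ ω : ENNReal) ∂μ =
      ENNReal.ofReal ((T - ∑ a ∈ Finset.range κ, D a * survival D T a a) / D T) := by
  have hsum : HasSum (fun a => D (a + κ) * survival D T (a + κ) (a + κ) / D T)
      ((T - ∑ a ∈ Finset.range κ, D a * survival D T a a) / D T) :=
    ((hasSum_nat_add_iff' (f := fun a => D a * survival D T a a) κ).2
      (hasSum_mul_survival h.prob_nonneg h.prob_le_one (fun d hd => h.prob_eq_of_le hd) h.pos
        h.prob_pos)).div_const (D T)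
  rw [lintegral_congr_ae (h.violationTime_ae_eq_tsum k κ), lintegral_tsum fun a =>
    (measurable_one.indicator (h.measurableSet_currentSet k (a + κ))).aemeasurable]
  simp_rw [lintegral_indicator_one (h.measurableSet_currentSet _ _), h.measure_currentSet]
  rw [← hsum.tsum_eq, ENNReal.ofReal_tsum_of_nonneg (fun a => ?_) hsum.summable]
  exact div_nonneg (mul_nonneg (h.prob_nonneg _) (survival_nonneg h.prob_le_one _ _))
    h.prob_pos.le

theorem integrable_violationTime (k κ : ℕ) :
    Integrable (fun ω => (violationTime lag T k κ ω : ℝ)) μ := by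
  have hfin : ∫⁻ ω, (violationTime lag T k κ ω : ENNReal) ∂μ ≠ ⊤ := by
    rw [h.lintegral_violationTime]
    exact ENNReal.ofReal_ne_top
  simpa only [ENNReal.toReal_natCast] using
    integrable_toReal_of_lintegral_ne_top (h.aemeasurable_violationTime k κ) hfin

theorem integral_violationTime (k κ : ℕ) : ∫ ω, (violationTime lag T k κ ω : ℝ) ∂μ =
    (∑ s ∈ Finset.range T, survival D T κ s) / D T := by
  have hnonneg : 0 ≤ (∑ s ∈ Finset.range T, survival D T κ s) / D T :=
    div_nonneg (Finset.sum_nonneg fun s _ => survival_nonneg h.prob_le_one _ _) h.prob_pos.le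
  have htoReal := integral_toReal (h.aemeasurable_violationTime k κ)
    (ae_of_all _ fun ω => ENNReal.natCast_lt_top _)
  simp only [ENNReal.toReal_natCast] at htoReal
  rw [htoReal, h.lintegral_violationTime, ← sum_survival h.pos, ENNReal.toReal_ofReal hnonneg]

end IsLagSequence

end Renewal

/-! ### The lags of the network -/

theorem iIndep_iSup_fiber {Ω ι κ : Type*} [mΩ : MeasurableSpace Ω] {μ : Measure Ω}
    [IsProbabilityMeasure μ] {m : ι → MeasurableSpace Ω} (hle : ∀ i, m i ≤ mΩ) (h : iIndep m μ)
    (r : ι → κ) : iIndep (fun k => ⨆ i ∈ {i | r i = k}, m i) μ := by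
  classical
  rw [iIndep_iff]
  intro s
  induction s using Finset.induction_on with
  | empty => intro f _; simp
  | insert a s ha ih =>
    intro f hf
    rw [Finset.prod_insert ha, Finset.set_biInter_insert,
      ← ih fun i hi => hf i (Finset.mem_insert_of_mem hi)]
    have hdisj : Disjoint {i | r i = a} {i | r i ∈ s} :=
      Set.disjoint_left.2 fun i hia his => ha (hia ▸ his)
    refine (Indep_iff _ _ μ).1 (indep_iSup_of_disjoint hle h hdisj) _ _
      (hf a (Finset.mem_insert_self _ _)) (Finset.measurableSet_biInter _ fun k hk => ?_)
    have hmono : (⨆ i ∈ {i | r i = k}, m i) ≤ ⨆ i ∈ {i | r i ∈ s}, m i :=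
      biSup_mono fun i (hi : r i = k) => show r i ∈ s from hi ▸ hk
    exact hmono _ (hf k (Finset.mem_insert_of_mem hk))

theorem measurable_nat_of_Icc_one {Ω : Type*} [MeasurableSpace Ω] {f : Ω → ℕ}
    (hf : ∀ d, MeasurableSet {ω | f ω ∈ Set.Icc 1 d}) : Measurable f := by
  refine measurable_of_Ioi fun d => ?_
  have heq : f ⁻¹' Set.Ioi d = (⋃ e, {ω | f ω ∈ Set.Icc 1 e}) \ {ω | f ω ∈ Set.Icc 1 d} := by
    ext ω
    simp only [Set.mem_preimage, Set.mem_Ioi, Set.mem_sdiff, Set.mem_iUnion, Set.mem_ofPred_eq,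
      Set.mem_Icc]
    exact ⟨fun h => ⟨⟨f ω, by lia, le_rfl⟩, by lia⟩, by rintro ⟨⟨e, he⟩, hd⟩; lia⟩
  rw [heq]
  exact (MeasurableSet.iUnion hf).diff (hf d)

/-- The round to which a primitive random variable belongs. -/
def Source.round : Source → ℕ
  | .sense j => j
  | .comp j => j
  | .sinr j _ => j

namespace Network

section Lags

variable {Ω : Type*}

open Classical in
/-- Time from the start of round `j` to the update it causes, and `0` if it causes none; an actual
update takes at least two slots, so the value `0` is unambiguous. -/
noncomputable def lag (N : Network) (ξ : (i : Source) → Ω → i.Val) (j : ℕ) (ω : Ω) : ℕ :=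
  if N.Success ξ j ω then N.delay ξ j ω else 0

/-- Number of transmission attempts in mode `m` that end at most `d` slots after the start of the
round. -/
def attemptBound (N : Network) (m : Mode) (d : ℕ) : ℕ := min (d - 1 - N.τ m) N.δ

/-- The event that the sensor senses in mode `m` in round `j` and its first `b` attempts fail. -/
def failureSet (N : Network) (ξ : (i : Source) → Ω → i.Val) (m : Mode) (j b : ℕ) : Set Ω :=
  {ω | (ξ (.sense j) ω : Bool) = true ∧ mode ξ j ω = m ∧ ∀ c ∈ Finset.Icc 1 b, N.Outage ξ m j c ω}

/-- The event that the sensor senses in mode `m` in round `j` and one of its first `b` attempts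
succeeds. -/
def deliverySet (N : Network) (ξ : (i : Source) → Ω → i.Val) (m : Mode) (j b : ℕ) : Set Ω :=
  {ω | (ξ (.sense j) ω : Bool) = true ∧ mode ξ j ω = m ∧
    ∃ c ∈ Finset.Icc 1 b, ¬ N.Outage ξ m j c ω}

open Classical in
/-- The primitive variables that determine `Network.failureSet`. -/
noncomputable def failureSources (j b : ℕ) : Finset Source :=
  {.sense j, .comp j} ∪ (Finset.Icc 1 b).image (Source.sinr j)

/-- The values of the primitive variables that make up `Network.failureSet`. -/
def failureValues (N : Network) (m : Mode) : (i : Source) → Set i.Val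
  | .sense _ => ({true} : Set Bool)
  | .comp _ => ({m} : Set Mode)
  | .sinr _ _ => {x : ℝ | N.W * Real.logb 2 (1 + x) < N.R m}

variable {N : Network} {ξ : (i : Source) → Ω → i.Val} {m : Mode} {j b d : ℕ} {ω : Ω}

theorem lag_eq_delay (h : N.Success ξ j ω) : N.lag ξ j ω = N.delay ξ j ω := if_pos h

theorem lag_ne_zero_iff : N.lag ξ j ω ≠ 0 ↔ N.Success ξ j ω := by
  by_cases h : N.Success ξ j ω
  · simp only [lag_eq_delay h, delay, h, iff_true]; lia
  · simp [lag, h]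

theorem lag_mem_Icc_iff : N.lag ξ j ω ∈ Set.Icc 1 d ↔ N.Success ξ j ω ∧ N.delay ξ j ω ≤ d := by
  rw [Set.mem_Icc, Nat.one_le_iff_ne_zero, lag_ne_zero_iff]
  exact and_congr_right fun h => by rw [lag_eq_delay h]

theorem attempts_spec (h : N.Success ξ j ω) : 1 ≤ N.attempts ξ j ω ∧ N.attempts ξ j ω ≤ N.δ ∧
    ¬ N.Outage ξ (mode ξ j ω) j (N.attempts ξ j ω) ω := by
  obtain ⟨-, c, hc, hcδ, hout⟩ := h
  have hmem := Nat.sInf_mem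
    (s := {c | 1 ≤ c ∧ ¬ N.Outage ξ (mode ξ j ω) j c ω}) ⟨c, hc, hout⟩
  exact ⟨hmem.1, le_trans (Nat.sInf_le ⟨hc, hout⟩) hcδ, hmem.2⟩

theorem two_add_le_delay (h : N.Success ξ j ω) : 2 + N.τ (mode ξ j ω) ≤ N.delay ξ j ω := by
  have := (attempts_spec h).1
  rw [delay]
  lia

theorem lag_le (hround : ∀ m, 1 + N.δ + N.τ m ≤ N.τr) (j : ℕ) (ω : Ω) : N.lag ξ j ω ≤ N.τr := by
  by_cases h : N.Success ξ j ω
  · have := (attempts_spec h).2.1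
    have := hround (mode ξ j ω)
    rw [lag_eq_delay h, delay]
    lia
  · simp [lag, h]

theorem lag_mem_Icc_iff_mem_deliverySet : N.lag ξ j ω ∈ Set.Icc 1 d ↔
    ω ∈ N.deliverySet ξ (mode ξ j ω) j (N.attemptBound (mode ξ j ω) d) := by
  rw [lag_mem_Icc_iff, delay, deliverySet, Set.mem_ofPred_eq, attemptBound]
  constructor
  · rintro ⟨h, hd⟩
    obtain ⟨hpos, hle, hout⟩ := attempts_spec h
    exact ⟨h.1, rfl, N.attempts ξ j ω, Finset.mem_Icc.2 (by lia), hout⟩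
  · rintro ⟨hs, -, c, hc, hout⟩
    rw [Finset.mem_Icc] at hc
    have : N.attempts ξ j ω ≤ c := Nat.sInf_le ⟨hc.1, hout⟩
    exact ⟨⟨hs, c, hc.1, by lia, hout⟩, by lia⟩

theorem setOf_lag_mem_Icc (N : Network) (ξ : (i : Source) → Ω → i.Val) (j d : ℕ) :
    {ω | N.lag ξ j ω ∈ Set.Icc 1 d} = N.deliverySet ξ .ec j (N.attemptBound .ec d) ∪
      N.deliverySet ξ .lc j (N.attemptBound .lc d) := by
  ext ω
  rw [Set.mem_ofPred_eq, lag_mem_Icc_iff_mem_deliverySet, Set.mem_union]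
  cases hm : mode ξ j ω <;> simp [deliverySet, hm]

theorem deliverySet_eq_diff : N.deliverySet ξ m j b =
    N.failureSet ξ m j 0 \ N.failureSet ξ m j b := by
  ext ω
  simp only [deliverySet, failureSet, Set.mem_ofPred_eq, Set.mem_sdiff, Finset.Icc_eq_empty_of_lt
    zero_lt_one, Finset.notMem_empty]
  push Not
  tauto

theorem failureSet_subset : N.failureSet ξ m j b ⊆ N.failureSet ξ m j 0 :=
  fun _ hω => ⟨hω.1, hω.2.1, by simp⟩

theorem failureSet_eq_biInter : N.failureSet ξ m j b =
    ⋂ i ∈ failureSources j b, ξ i ⁻¹' N.failureValues m i := by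
  ext ω
  simp only [failureSources, Finset.mem_union, Finset.mem_insert, Finset.mem_singleton,
    Finset.mem_image, Set.mem_iInter]
  constructor
  · rintro ⟨hs, hm, hout⟩ i ((rfl | rfl) | ⟨c, hc, rfl⟩)
    exacts [hs, hm, hout c hc]
  · exact fun h => ⟨h _ (.inl (.inl rfl)), h _ (.inl (.inr rfl)),
      fun c hc => h _ (.inr ⟨c, hc, rfl⟩)⟩

theorem round_of_mem_failureSources {i : Source} (hi : i ∈ failureSources j b) : i.round = j := by
  simp only [failureSources, Finset.mem_union, Finset.mem_insert, Finset.mem_singleton,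
    Finset.mem_image] at hi
  obtain (rfl | rfl) | ⟨c, -, rfl⟩ := hi <;> rfl

theorem measurableSet_failureValues (N : Network) (m : Mode) :
    ∀ i, MeasurableSet (N.failureValues m i)
  | .sense _ => measurableSet_singleton (α := Bool) true
  | .comp _ => MeasurableSpace.measurableSet_top (α := Mode)
  | .sinr _ _ => measurableSet_lt (f := fun x : ℝ => N.W * Real.logb 2 (1 + x))
      (by unfold Real.logb; fun_prop) measurable_const

section Measurability

variable [mΩ : MeasurableSpace Ω] (hξ : ∀ i : Source, i.round = j → Measurable (ξ i))
include hξ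

theorem measurableSet_failureSet : MeasurableSet (N.failureSet ξ m j b) := by
  rw [failureSet_eq_biInter]
  exact Finset.measurableSet_biInter _ fun i hi =>
    hξ i (round_of_mem_failureSources hi) (N.measurableSet_failureValues m i)

theorem measurableSet_deliverySet : MeasurableSet (N.deliverySet ξ m j b) := by
  rw [deliverySet_eq_diff]
  exact (measurableSet_failureSet hξ).diff (measurableSet_failureSet hξ)

theorem measurable_lag : Measurable (N.lag ξ j) :=
  measurable_nat_of_Icc_one fun d => by
    rw [setOf_lag_mem_Icc]
    exact (measurableSet_deliverySet hξ).union (measurableSet_deliverySet hξ)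

end Measurability

end Lags

/-- Probability of each computing mode. -/
def modeProb (N : Network) : Mode → ℝ
  | .ec => N.pe
  | .lc => 1 - N.pe

/-- Probability that a round causes an update at most `d` slots after its start. -/
noncomputable def deliveryProb (N : Network) (d : ℕ) : ℝ :=
  N.ps * (N.modeProb .ec * N.ζ .ec (N.attemptBound .ec d) +
    N.modeProb .lc * N.ζ .lc (N.attemptBound .lc d))

section Probabilities

variable {N : Network}

theorem attemptBound_eq {d : ℕ} {m : Mode} (hd : 1 + N.δ + N.τ m ≤ d) :
    N.attemptBound m d = N.δ := by
  rw [attemptBound]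
  lia

theorem deliveryProb_eq_px (hround : ∀ m, 1 + N.δ + N.τ m ≤ N.τr) {d : ℕ} (hd : N.τr ≤ d) :
    N.deliveryProb d = N.px := by
  rw [deliveryProb, px, attemptBound_eq ((hround _).trans hd),
    attemptBound_eq ((hround _).trans hd), modeProb, modeProb]

theorem ζ_pos {m : Mode} (h0 : 0 ≤ N.po m) (h1 : N.po m < 1) {c : ℕ} (hc : c ≠ 0) :
    0 < N.ζ m c := by
  rw [ζ, zpow_natCast, sub_pos]
  exact pow_lt_one₀ h0 h1 hc

theorem successProb_pos (h0 : ∀ m, 0 ≤ N.po m) (hpo : ∀ m, N.po m < 1) (hδ : 1 ≤ N.δ)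
    (hm : ∀ m, 0 ≤ N.modeProb m) : 0 < N.pe * N.ζ .ec N.δ + (1 - N.pe) * N.ζ .lc N.δ := by
  have he := ζ_pos (h0 .ec) (hpo .ec) (Nat.one_le_iff_ne_zero.1 hδ)
  have hl := ζ_pos (h0 .lc) (hpo .lc) (Nat.one_le_iff_ne_zero.1 hδ)
  rcases (show 0 ≤ N.pe from hm .ec).eq_or_lt with hpe | hpe
  · rw [← hpe]; simpa using hl
  · exact add_pos_of_pos_of_nonneg (mul_pos hpe he) (mul_nonneg (hm .lc) hl.le)

namespace IsModel

variable {Ω : Type*} [mΩ : MeasurableSpace Ω] {μ : Measure Ω} {ξ : (i : Source) → Ω → i.Val}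
  (h : N.IsModel ξ μ)
include h

theorem isProbabilityMeasure : IsProbabilityMeasure μ := h.indep.isProbabilityMeasure

theorem iIndepFun_lag : iIndepFun (N.lag ξ) μ := by
  have := h.isProbabilityMeasure
  have hrounds := iIndep_iSup_fiber (fun i => (h.measurable i).comap_le) h.indep.iIndep Source.round
  rw [iIndep_iff] at hrounds
  rw [iIndepFun_iff_measure_inter_preimage_eq_mul]
  refine fun S A hA => hrounds S fun j hj => measurable_lag
    (mΩ := ⨆ i ∈ {i : Source | i.round = j}, MeasurableSpace.comap (ξ i) inferInstance)
    (fun i hi => ?_) (hA j hj)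
  exact (comap_measurable (ξ i)).mono
    (le_biSup (fun i => MeasurableSpace.comap (ξ i) inferInstance) hi) le_rfl

theorem measureReal_mode (m : Mode) (j : ℕ) : μ.real {ω | mode ξ j ω = m} = N.modeProb m := by
  have := h.isProbabilityMeasure
  cases m with
  | ec => exact h.comp_prob j
  | lc =>
    have hmeas : MeasurableSet {ω | mode ξ j ω = Mode.ec} :=
      h.measurable (.comp j) (MeasurableSpace.measurableSet_top (α := Mode) (s := {Mode.ec}))
    have heq : {ω | mode ξ j ω = Mode.lc} = {ω | mode ξ j ω = Mode.ec}ᶜ := by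
      ext ω
      simp only [Set.mem_ofPred_eq, Set.mem_compl_iff]
      cases mode ξ j ω <;> simp
    rw [heq, probReal_compl_eq_one_sub hmeas, modeProb, ← h.comp_prob j]
    rfl

theorem measureReal_failureSet (m : Mode) (j b : ℕ) :
    μ.real (N.failureSet ξ m j b) = N.ps * N.modeProb m * N.po m ^ b := by
  classical
  have hsinr : ∀ c, μ.real (ξ (.sinr j c) ⁻¹' N.failureValues m (.sinr j c)) = N.po m :=
    h.outage_prob m j
  rw [failureSet_eq_biInter, measureReal_def, h.indep.measure_inter_preimage_eq_mul _
    fun i _ => N.measurableSet_failureValues m i, ENNReal.toReal_prod, failureSources,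
    Finset.prod_union (by simp [Finset.disjoint_left]), Finset.prod_pair (by simp),
    Finset.prod_image fun c _ c' _ hcc => by simpa using hcc]
  simp only [← measureReal_def, hsinr, Finset.prod_const, Nat.card_Icc, Nat.add_sub_cancel]
  exact congrArg₂ (· * · * _) (h.sense_prob j) (h.measureReal_mode m j)

theorem measureReal_deliverySet (m : Mode) (j b : ℕ) :
    μ.real (N.deliverySet ξ m j b) = N.ps * (N.modeProb m * N.ζ m b) := by
  have := h.isProbabilityMeasure
  rw [deliverySet_eq_diff, measureReal_sdiff failureSet_subset
    (measurableSet_failureSet fun i _ => h.measurable i), h.measureReal_failureSet,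
    h.measureReal_failureSet, ζ, zpow_natCast]
  ring

theorem measureReal_lag_mem_Icc (j d : ℕ) :
    μ.real {ω | N.lag ξ j ω ∈ Set.Icc 1 d} = N.deliveryProb d := by
  have := h.isProbabilityMeasure
  have hdisj : Disjoint (N.deliverySet ξ .ec j (N.attemptBound .ec d))
      (N.deliverySet ξ .lc j (N.attemptBound .lc d)) :=
    Set.disjoint_left.2 fun ω hec hlc => Mode.noConfusion (hec.2.1.symm.trans hlc.2.1)
  rw [setOf_lag_mem_Icc, measureReal_union hdisj
    (measurableSet_deliverySet fun i _ => h.measurable i), h.measureReal_deliverySet,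
    h.measureReal_deliverySet, deliveryProb, mul_add]

theorem modeProb_nonneg (m : Mode) : 0 ≤ N.modeProb m := h.measureReal_mode m 0 ▸ measureReal_nonneg

theorem po_nonneg (m : Mode) : 0 ≤ N.po m := h.outage_prob m 0 0 ▸ measureReal_nonneg

theorem isLagSequence (hδ : 1 ≤ N.δ) (hround : ∀ m, 1 + N.δ + N.τ m ≤ N.τr) (hps : 0 < N.ps)
    (hpo : ∀ m, N.po m < 1) : IsLagSequence μ (N.lag ξ) N.τr N.deliveryProb where
  pos := by have := hround .ec; lia
  measurable j := measurable_lag fun i _ => h.measurable i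
  indep := h.iIndepFun_lag
  prob := h.measureReal_lag_mem_Icc
  lag_le := lag_le hround
  prob_pos := by
    rw [deliveryProb_eq_px hround le_rfl]
    exact mul_pos hps (successProb_pos h.po_nonneg hpo hδ h.modeProb_nonneg)

end IsModel

end Probabilities

end Network

/-! ### Age of information -/

/-- The least natural number exceeding `v`. -/
noncomputable def ageThreshold (v : ℝ) : ℕ := (⌊v⌋ + 1).toNat

theorem ageThreshold_le_iff {v : ℝ} {a : ℕ} : ageThreshold v ≤ a ↔ v < a := by
  rw [ageThreshold, Int.toNat_le, Int.add_one_le_iff, Int.floor_lt, Int.cast_natCast]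

theorem floor_eq_of_ageThreshold_eq_succ {v : ℝ} {n : ℕ} (h : ageThreshold v = n + 1) :
    ⌊v⌋ = n := by
  rw [ageThreshold] at h
  lia

namespace Network

variable {N : Network} {Ω : Type*} {ξ : (i : Source) → Ω → i.Val} {t : ℕ} {ω : Ω}

theorem lastGen_le_iff {b : ℕ} : N.lastGen ξ t ω ≤ b ↔
    ∀ j ≤ t, N.Success ξ j ω → j * N.τr + N.delay ξ j ω ≤ t → j * N.τr ≤ b := by
  rw [lastGen, Finset.sup_le_iff]
  simp only [Finset.mem_filter, Finset.mem_range, Nat.lt_succ_iff]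
  exact ⟨fun h j hj hs hd => h j ⟨hj, hs, hd⟩, fun h j hj => h j hj.1 hj.2.1 hj.2.2⟩

theorem lastGen_le : N.lastGen ξ t ω ≤ t := lastGen_le_iff.2 fun _ _ _ h => by lia

theorem lastGen_eq_zero_or (N : Network) (ξ : (i : Source) → Ω → i.Val) (t : ℕ) (ω : Ω) :
    N.lastGen ξ t ω = 0 ∨
      ∃ j, N.Success ξ j ω ∧ j * N.τr + N.delay ξ j ω ≤ t ∧ N.lastGen ξ t ω = j * N.τr := by
  classical
  rw [lastGen]
  obtain he | hne := Finset.eq_empty_or_nonempty ((Finset.range (t + 1)).filter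
    fun j => N.Success ξ j ω ∧ j * N.τr + N.delay ξ j ω ≤ t)
  · exact .inl (by rw [he]; rfl)
  · obtain ⟨j, hj, hsup⟩ := Finset.exists_mem_eq_sup _ hne fun j => j * N.τr
    exact .inr ⟨j, (Finset.mem_filter.1 hj).2.1, (Finset.mem_filter.1 hj).2.2, hsup⟩

theorem aoi_eq_natCast : N.aoi ξ t ω = ((t - N.lastGen ξ t ω : ℕ) : ℝ) := by
  rw [aoi, Nat.cast_sub lastGen_le]

theorem setOf_lt_aoi_eq_staleSet (hτr : 0 < N.τr) {v : ℝ} (ht : ageThreshold v ≤ t) :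
    {ω | v < N.aoi ξ t ω} = staleSet (N.lag ξ) N.τr t (ageThreshold v) := by
  ext ω
  have hle := lastGen_le (N := N) (ξ := ξ) (t := t) (ω := ω)
  rw [Set.mem_ofPred_eq, aoi_eq_natCast, ← ageThreshold_le_iff, Nat.le_sub_iff_add_le' hle,
    ← Nat.le_sub_iff_add_le ht, lastGen_le_iff]
  constructor
  · intro h j hj hlag
    rw [mem_ageWindow hτr] at hj
    rw [lag_mem_Icc_iff] at hlag
    have := h j (by nlinarith) hlag.1 (by lia)
    lia
  · intro h j _ hs hd
    by_contra! hlt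
    exact h j ((mem_ageWindow hτr).2 (by lia)) (lag_mem_Icc_iff.2 ⟨hs, by lia⟩)

/- The initial data, generated at time `0`, is old by the time considered. -/
theorem exists_two_add_le_aoi (ht : 2 + N.τ .ec ≤ t) (ω : Ω) :
    ∃ m, (2 + N.τ m : ℝ) ≤ N.aoi ξ t ω := by
  suffices ∃ m, 2 + N.τ m ≤ t - N.lastGen ξ t ω by
    rw [aoi_eq_natCast]
    exact_mod_cast this
  obtain h0 | ⟨j, hs, hd, hj⟩ := lastGen_eq_zero_or N ξ t ω
  · exact ⟨.ec, by rwa [h0]⟩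
  · have := two_add_le_delay hs
    exact ⟨mode ξ j ω, by lia⟩

section Cycle

theorem updateRound_eq_deliveryRound (k : ℕ) :
    N.updateRound ξ k ω = deliveryRound (N.lag ξ) k ω := by
  simp only [updateRound, deliveryRound, lag_ne_zero_iff]

variable (hinf : {j | N.lag ξ j ω ≠ 0}.Infinite)
include hinf

theorem Z_eq_lag (k : ℕ) : N.Z ξ k ω = N.lag ξ (deliveryRound (N.lag ξ) k ω) ω := by
  rw [Z, updateRound_eq_deliveryRound,
    lag_eq_delay (lag_ne_zero_iff.1 (lag_deliveryRound_ne_zero hinf k))]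

theorem add_X_eq_peakAge (k : ℕ) : N.τr + N.X ξ (k + 1) ω = peakAge (N.lag ξ) N.τr k ω := by
  have hpeak : (deliveryRound (N.lag ξ) k ω * N.τr + peakAge (N.lag ξ) N.τr k ω : ℝ) =
      deliveryRound (N.lag ξ) (k + 1) ω * N.τr +
        N.lag ξ (deliveryRound (N.lag ξ) (k + 1) ω) ω :=
    mod_cast deliveryRound_mul_add_peakAge hinf N.τr k
  rw [X, updateTime, Z_eq_lag hinf, updateRound_eq_deliveryRound, updateRound_eq_deliveryRound,
    Nat.add_sub_cancel]
  linarith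

variable (hle : ∀ j, N.lag ξ j ω ≤ N.τr)
include hle

theorem U_eq_violationTime (k : ℕ) :
    N.U ξ (k + 1) ω = violationTime (N.lag ξ) N.τr k 0 ω := by
  rw [violationTime, Nat.max_zero, Nat.cast_sub (lag_deliveryRound_le_peakAge hinf hle k),
    ← add_X_eq_peakAge hinf, ← Z_eq_lag hinf, U, X, Nat.add_sub_cancel, updateTime, updateTime]
  ring

theorem g_eq_violationTime (v : ℝ) (k : ℕ) :
    N.g ξ v (k + 1) ω = violationTime (N.lag ξ) N.τr k (ageThreshold v) ω := by
  have hpeak := lag_deliveryRound_le_peakAge hinf hle k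
  rw [g, add_X_eq_peakAge hinf, Nat.add_sub_cancel, Z_eq_lag hinf, violationTime]
  simp only [← ageThreshold_le_iff]
  split_ifs with hlag hage
  · rw [max_eq_left hlag, Nat.cast_sub hpeak]
  · obtain ⟨n, hn⟩ := Nat.exists_eq_succ_of_ne_zero (by lia : ageThreshold v ≠ 0)
    rw [max_eq_right (by lia), Nat.cast_sub hage, floor_eq_of_ageThreshold_eq_succ hn, hn,
      Nat.cast_succ, Int.cast_natCast]
  · rw [max_eq_right (by lia), Nat.sub_eq_zero_of_le (by lia), Nat.cast_zero]

end Cycle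

end Network

/-! ### The closed form -/

namespace Network

/-- Probability that a successful update in mode `m` takes at most `a` slots. -/
noncomputable def delayCDF (N : Network) (m : Mode) (a : ℕ) : ℝ :=
  N.ζ m (N.attemptBound m a) / N.ζ m N.δ

/-- Probability that the peak age of a cycle that ends with an update in mode `m` exceeds `a`. -/
noncomputable def peakTail (N : Network) (m : Mode) (a : ℕ) : ℝ :=
  if a < N.τr then 1 else (1 - N.px) ^ (a / N.τr - 1) * (1 - N.px * N.delayCDF m (a % N.τr))

/-- Mean delay of a successful update in mode `m`. -/
noncomputable def meanDelay (N : Network) (m : Mode) : ℝ := 1 + N.τ m + N.F₁ m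

/-- Mean excess of the peak age over `κ` for cycles that end with an update in mode `m`. -/
noncomputable def meanExcess (N : Network) (m : Mode) (κ : ℕ) : ℝ :=
  N.τr / N.px + N.meanDelay m - ∑ a ∈ Finset.range κ, N.peakTail m a

/-- Mean number of slots with age at least `κ` in a cycle from an update in mode `m'` to one in mode
`m`: the mean length of the cycle, less the probability that the age `a` occurs in it for each
`a < κ`. The age `a` occurs if it is between the delay of the first update and the peak age, which
are independent. -/
noncomputable def cycleViolation (N : Network) (m' m : Mode) (κ : ℕ) : ℝ :=
  N.τr / N.px + N.meanDelay m - N.meanDelay m' -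
    ∑ a ∈ Finset.range κ, N.delayCDF m' a * N.peakTail m a

section Delay

variable {N : Network} {m : Mode}

theorem ζ_natCast (c : ℕ) : N.ζ m c = 1 - N.po m ^ c := by rw [ζ, zpow_natCast]

theorem ζ_one : N.ζ m 1 = 1 - N.po m := by rw [ζ, zpow_one]

theorem delayCDF_eq_zero {a : ℕ} (h : a < 2 + N.τ m) : N.delayCDF m a = 0 := by
  have : N.attemptBound m a = 0 := by rw [attemptBound]; lia
  simp [delayCDF, this, ζ]

variable (hζ : N.ζ m N.δ ≠ 0)
include hζ

theorem one_le_δ : 1 ≤ N.δ := by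
  rw [Nat.one_le_iff_ne_zero]
  intro h
  simp [h, ζ] at hζ

theorem one_sub_po_ne_zero : 1 - N.po m ≠ 0 := fun h => hζ <| by
  rw [ζ_natCast, ← sub_eq_zero.1 h, one_pow, sub_self]

theorem delayCDF_eq_one {a : ℕ} (h : 1 + N.δ + N.τ m ≤ a) : N.delayCDF m a = 1 := by
  rw [delayCDF, attemptBound_eq h, div_self hζ]

theorem sum_one_sub_delayCDF {c : ℕ} (hc : c ≤ N.δ) :
    ∑ a ∈ Finset.range (1 + N.τ m + c), (1 - N.delayCDF m a) =
      1 + N.τ m + ((1 - N.po m ^ c) / N.ζ m 1 - c * N.po m ^ N.δ) / N.ζ m N.δ := by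
  have hpo := one_sub_po_ne_zero hζ
  induction c with
  | zero =>
    rw [add_zero, Finset.sum_congr rfl fun a ha => by
      rw [delayCDF_eq_zero (by have := Finset.mem_range.1 ha; lia), sub_zero]]
    simp
  | succ c ih =>
    have hb : N.attemptBound m (1 + N.τ m + c) = c := by rw [attemptBound]; lia
    rw [← add_assoc, Finset.sum_range_succ, ih (by lia), delayCDF, hb, ζ_natCast c, ζ_one]
    rw [ζ_natCast] at hζ ⊢
    push_cast
    field_simp
    ring

theorem sum_one_sub_delayCDF_eq_meanDelay {κ : ℕ} (hκ : 1 + N.δ + N.τ m ≤ κ) :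
    ∑ a ∈ Finset.range κ, (1 - N.delayCDF m a) = N.meanDelay m := by
  obtain ⟨s, rfl⟩ := Nat.exists_eq_add_of_le hκ
  have htail : ∑ a ∈ Finset.range s, (1 - N.delayCDF m (1 + N.δ + N.τ m + a)) = 0 :=
    Finset.sum_eq_zero fun a _ => by rw [delayCDF_eq_one hζ (by lia), sub_self]
  rw [Finset.sum_range_add, htail, add_zero, add_right_comm, sum_one_sub_delayCDF hζ le_rfl,
    meanDelay, F₁, ← ζ_natCast, sub_div, div_div_cancel_left' hζ, one_div]

end Delay

section PeakAge

variable {N : Network} (hround : ∀ m, 1 + N.δ + N.τ m ≤ N.τr) {m : Mode}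

theorem peakTail_of_lt {a : ℕ} (h : a < N.τr) : N.peakTail m a = 1 := if_pos h

include hround

/- Condition on the first round of the cycle: with probability `1 - p_x` it brings no update. -/
theorem peakTail_add (hζ : N.ζ m N.δ ≠ 0) (a : ℕ) : N.peakTail m (a + N.τr) =
    (1 - N.px) * N.peakTail m a + N.px * (1 - N.delayCDF m a) := by
  have hτr : 0 < N.τr := by have := hround m; lia
  rw [peakTail, if_neg (by lia), Nat.add_div_right _ hτr, Nat.add_mod_right, Nat.succ_sub_one,
    peakTail]
  split_ifs with h
  · rw [Nat.div_eq_of_lt h, Nat.mod_eq_of_lt h]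
    ring
  · obtain ⟨b, hb⟩ := Nat.exists_eq_succ_of_ne_zero (Nat.div_pos (not_lt.1 h) hτr).ne'
    rw [delayCDF_eq_one hζ (a := a) ((hround m).trans (not_lt.1 h)), hb, Nat.succ_sub_one, pow_succ]
    ring

variable (hζ : N.ζ m N.δ ≠ 0)
include hζ

theorem peakTail_eq_one {a : ℕ} (h : a < N.τr + 2 + N.τ m) : N.peakTail m a = 1 := by
  obtain ha | ha := lt_or_ge a N.τr
  · exact peakTail_of_lt ha
  · have := one_le_δ hζ
    have := hround m
    obtain ⟨b, rfl⟩ := Nat.exists_eq_add_of_le' ha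
    rw [peakTail_add hround hζ, peakTail_of_lt (by lia), delayCDF_eq_zero (by lia)]
    ring

theorem meanExcess_of_le {κ : ℕ} (h : κ ≤ N.τr + 2 + N.τ m) :
    N.meanExcess m κ = N.τr / N.px + N.meanDelay m - κ := by
  rw [meanExcess, Finset.sum_congr rfl fun a ha => peakTail_eq_one hround hζ
    ((Finset.mem_range.1 ha).trans_le h)]
  simp

variable (hpx : N.px ≠ 0)
include hpx

theorem meanExcess_add (κ : ℕ) : N.meanExcess m (κ + N.τr) = (1 - N.px) * N.meanExcess m κ +
    N.px * (N.meanDelay m - ∑ a ∈ Finset.range κ, (1 - N.delayCDF m a)) := by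
  have hfirst : ∑ a ∈ Finset.range N.τr, N.peakTail m a = N.τr := by
    rw [Finset.sum_congr rfl fun a ha => peakTail_of_lt (Finset.mem_range.1 ha)]
    simp
  rw [meanExcess, meanExcess, add_comm κ, Finset.sum_range_add, hfirst]
  simp_rw [add_comm N.τr, peakTail_add hround hζ]
  rw [Finset.sum_add_distrib, ← Finset.mul_sum, ← Finset.mul_sum]
  field_simp
  ring

theorem meanExcess_add_mul {κ : ℕ} (h : κ ≤ N.τr + 2 + N.τ m) (y : ℕ) :
    N.meanExcess m (κ + (y + 1) * N.τr) = (1 - N.px) ^ y *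
      ((1 - N.px) * (N.τr / N.px + N.meanDelay m - κ) +
        N.px * (N.meanDelay m - ∑ a ∈ Finset.range κ, (1 - N.delayCDF m a))) := by
  induction y with
  | zero => rw [zero_add, one_mul, meanExcess_add hround hζ hpx, meanExcess_of_le hround hζ h,
      pow_zero, one_mul]
  | succ y ih =>
    have hκ : 1 + N.δ + N.τ m ≤ κ + (y + 1) * N.τr := by
      have := hround m
      have := Nat.le_mul_of_pos_left N.τr y.succ_pos
      lia
    rw [Nat.succ_mul, ← add_assoc, meanExcess_add hround hζ hpx, ih,
      sum_one_sub_delayCDF_eq_meanDelay hζ hκ, pow_succ]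
    ring

end PeakAge

section Cycle

variable {N : Network} {m' m : Mode} {κ : ℕ}

theorem cycleViolation_of_le (h : κ ≤ 2 + N.τ m') :
    N.cycleViolation m' m κ = N.τr / N.px + N.meanDelay m - N.meanDelay m' := by
  rw [cycleViolation, Finset.sum_eq_zero fun a ha => by
    rw [delayCDF_eq_zero ((Finset.mem_range.1 ha).trans_le h), zero_mul], sub_zero]

theorem cycleViolation_of_le_τr (h : κ ≤ N.τr) : N.cycleViolation m' m κ =
    N.τr / N.px + N.meanDelay m - N.meanDelay m' -
      (κ - ∑ a ∈ Finset.range κ, (1 - N.delayCDF m' a)) := by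
  have hsum : ∑ a ∈ Finset.range κ, N.delayCDF m' a * N.peakTail m a =
      ∑ a ∈ Finset.range κ, N.delayCDF m' a :=
    Finset.sum_congr rfl fun a ha => by
      rw [peakTail_of_lt ((Finset.mem_range.1 ha).trans_le h), mul_one]
  rw [cycleViolation, hsum, Finset.sum_sub_distrib]
  simp

theorem cycleViolation_eq_meanExcess (hround : ∀ m, 1 + N.δ + N.τ m ≤ N.τr)
    (hζ : N.ζ m' N.δ ≠ 0) (h : 1 + N.δ + N.τ m' ≤ κ) :
    N.cycleViolation m' m κ = N.meanExcess m κ := by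
  have hsum : ∑ a ∈ Finset.range κ, N.delayCDF m' a * N.peakTail m a =
      ∑ a ∈ Finset.range κ, N.peakTail m a - ∑ a ∈ Finset.range κ, (1 - N.delayCDF m' a) := by
    rw [← Finset.sum_sub_distrib]
    refine Finset.sum_congr rfl fun a _ => ?_
    obtain ha | ha := lt_or_ge a N.τr
    · rw [peakTail_of_lt ha]; ring
    · rw [delayCDF_eq_one hζ ((hround m').trans ha)]; ring
  rw [cycleViolation, hsum, sum_one_sub_delayCDF_eq_meanDelay hζ h, meanExcess]
  ring

end Cycle

section Regimes

variable {N : Network} {v : ℝ} {m' m : Mode} {y : ℕ}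

theorem lt_v₁_iff : v < N.v₁ m' ↔ ageThreshold v ≤ 2 + N.τ m' := by
  rw [ageThreshold_le_iff, v₁]; push_cast; rfl

theorem lt_v₂_iff : v < N.v₂ m' ↔ ageThreshold v ≤ 1 + N.δ + N.τ m' := by
  rw [ageThreshold_le_iff, v₂]; push_cast; rfl

theorem lt_v₃_iff : v < N.v₃ m y ↔ ageThreshold v ≤ y * N.τr + 2 + N.τ m := by
  rw [ageThreshold_le_iff, v₃]; push_cast; rfl

theorem lt_v₄_iff : v < N.v₄ m y ↔ ageThreshold v ≤ y * N.τr + 1 + N.δ + N.τ m := by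
  rw [ageThreshold_le_iff, v₄]; push_cast; rfl

theorem v₁_le_v₂ (hδ : 1 ≤ N.δ) : N.v₁ m' ≤ N.v₂ m' := by
  have : (1 : ℝ) ≤ N.δ := mod_cast hδ
  rw [v₁, v₂]
  linarith

theorem yIdx_spec (hτr : 0 < N.τr) (h : N.v₃ m 1 ≤ v) :
    1 ≤ N.yIdx v m ∧ N.v₃ m (N.yIdx v m) ≤ v ∧ v < N.v₃ m (N.yIdx v m + 1) := by
  have hτr' : (0 : ℝ) < N.τr := mod_cast hτr
  have hle : (N.τr : ℝ) ≤ v - 2 - N.τ m := by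
    rw [v₃, Nat.cast_one] at h
    linarith
  refine ⟨(Nat.one_le_floor_iff _).2 ((one_le_div hτr').2 hle), ?_, ?_⟩
  · have := (le_div_iff₀ hτr').1 (Nat.floor_le (div_nonneg (hτr'.le.trans hle) hτr'.le))
    rw [v₃, yIdx]
    linarith
  · have := (div_lt_iff₀ hτr').1 (Nat.lt_floor_add_one ((v - 2 - N.τ m) / N.τr))
    rw [v₃, yIdx, Nat.cast_succ]
    linarith

theorem G_of_lt_v₁ (h : v < N.v₁ m') : N.G v m' m = N.cycleViolation m' m (ageThreshold v) := by
  rw [G, if_pos h, cycleViolation_of_le (lt_v₁_iff.1 h), meanDelay, meanDelay]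
  ring

variable (hround : ∀ m, 1 + N.δ + N.τ m ≤ N.τr) (hζ : ∀ m, N.ζ m N.δ ≠ 0)
include hround hζ

theorem G_of_lt_v₂ (h₁ : N.v₁ m' ≤ v) (h₂ : v < N.v₂ m') :
    N.G v m' m = N.cycleViolation m' m (ageThreshold v) := by
  rw [G, if_neg h₁.not_gt, if_pos h₂]
  rw [← not_lt, lt_v₁_iff] at h₁
  rw [lt_v₂_iff] at h₂
  obtain ⟨a, ha⟩ := Nat.exists_eq_add_of_le (by lia : 1 + N.τ m' + 1 ≤ ageThreshold v)
  have hfloor : ⌊v⌋ = (1 + N.τ m' + a : ℕ) := floor_eq_of_ageThreshold_eq_succ (by lia)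
  have hexp : ((1 + N.τ m' + a : ℕ) : ℤ) - 1 - N.τ m' = a := by push_cast; ring
  have hδ := hζ m'
  have hpo := one_sub_po_ne_zero (hζ m')
  rw [cycleViolation_of_le_τr (h₂.trans (hround m')), ha, hfloor, hexp, zpow_natCast,
    add_assoc (1 + N.τ m') 1 a, sum_one_sub_delayCDF (hζ m') (by lia), meanDelay, meanDelay, F₁, F₁,
    ζ_one, ζ_one]
  rw [ζ_natCast (m := m')] at hδ ⊢
  push_cast
  field_simp
  ring

theorem G_of_lt_v₃ (h₂ : N.v₂ m' ≤ v) (h₃ : v < N.v₃ m 1) :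
    N.G v m' m = N.cycleViolation m' m (ageThreshold v) := by
  rw [G, if_neg ((v₁_le_v₂ (one_le_δ (hζ m'))).trans h₂).not_gt, if_neg h₂.not_gt, if_pos h₃]
  rw [← not_lt, lt_v₂_iff] at h₂
  rw [lt_v₃_iff, one_mul] at h₃
  obtain ⟨n, hn⟩ := Nat.exists_eq_succ_of_ne_zero (by lia : ageThreshold v ≠ 0)
  rw [cycleViolation_eq_meanExcess hround (hζ m') (by lia), meanExcess_of_le hround (hζ m) h₃,
    meanDelay, floor_eq_of_ageThreshold_eq_succ hn, hn]
  push_cast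
  ring

variable (hpx : N.px ≠ 0)
include hpx

theorem cycleViolation_of_v₃_le (h₂ : N.v₂ m' ≤ v) (h₃ : N.v₃ m 1 ≤ v) : ∃ z x : ℕ,
    N.yIdx v m = z + 1 ∧ ⌊v⌋ = ((z + 1) * N.τr + 1 + N.τ m + x : ℕ) ∧
    N.cycleViolation m' m (ageThreshold v) = (1 - N.px) ^ z *
      ((1 - N.px) * (N.τr / N.px + N.F₁ m - (x + 1)) +
        N.px * (N.meanDelay m -
          ∑ a ∈ Finset.range (1 + N.τ m + (x + 1)), (1 - N.delayCDF m a))) := by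
  have hτr : 0 < N.τr := by have := hround m; lia
  obtain ⟨hy, hle, hlt⟩ := yIdx_spec hτr h₃
  obtain ⟨z, hz⟩ := Nat.exists_eq_add_of_le' hy
  rw [← not_lt, lt_v₂_iff] at h₂
  rw [hz, ← not_lt, lt_v₃_iff] at hle
  rw [hz, lt_v₃_iff, Nat.succ_mul] at hlt
  obtain ⟨x, hx⟩ := Nat.exists_eq_add_of_le
    (by lia : (z + 1) * N.τr + 1 + N.τ m + 1 ≤ ageThreshold v)
  refine ⟨z, x, hz, floor_eq_of_ageThreshold_eq_succ (by lia), ?_⟩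
  rw [cycleViolation_eq_meanExcess hround (hζ m') (by lia),
    (by lia : ageThreshold v = 1 + N.τ m + (x + 1) + (z + 1) * N.τr),
    meanExcess_add_mul hround (hζ m) hpx (by lia), meanDelay]
  push_cast
  ring

theorem G_of_v₃_le (h₂ : N.v₂ m' ≤ v) (h₃ : N.v₃ m 1 ≤ v) :
    N.G v m' m = N.cycleViolation m' m (ageThreshold v) := by
  obtain ⟨z, x, hz, hfloor, hcycle⟩ := cycleViolation_of_v₃_le hround hζ hpx h₂ h₃
  have hF₃ : N.F₃ v m (z + 1) = x := by rw [F₃, hfloor]; push_cast; ring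
  have hv₄ : v < N.v₄ m (z + 1) ↔ x < N.δ := by
    rw [lt_v₄_iff, ageThreshold, hfloor]
    lia
  have hδ := hζ m
  have hpo := one_sub_po_ne_zero (hζ m)
  rw [ζ_natCast] at hδ
  simp only [G]
  rw [if_neg ((v₁_le_v₂ (one_le_δ (hζ m'))).trans h₂).not_gt, if_neg h₂.not_gt, if_neg h₃.not_gt,
    hcycle, hz, hF₃, Nat.add_sub_cancel]
  split_ifs with h₄ <;> rw [hv₄] at h₄
  · rw [sum_one_sub_delayCDF (c := x + 1) (hζ m) h₄, meanDelay, F₁, F₂, ζ_one, ζ_natCast,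
      ζ_natCast, hfloor, zpow_natCast]
    congr 1
    push_cast
    field_simp
    ring
  · rw [sum_one_sub_delayCDF_eq_meanDelay (hζ m) (by lia), sub_self, mul_zero, add_zero, pow_succ,
      F₁, ζ_one, ζ_natCast]
    push_cast
    field_simp
    ring

theorem G_eq_cycleViolation (v : ℝ) (m' m : Mode) :
    N.G v m' m = N.cycleViolation m' m (ageThreshold v) := by
  obtain h₁ | h₁ := lt_or_ge v (N.v₁ m')
  · exact G_of_lt_v₁ h₁
  obtain h₂ | h₂ := lt_or_ge v (N.v₂ m')
  · exact G_of_lt_v₂ hround hζ h₁ h₂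
  obtain h₃ | h₃ := lt_or_ge v (N.v₃ m 1)
  · exact G_of_lt_v₃ hround hζ h₂ h₃
  · exact G_of_v₃_le hround hζ hpx h₂ h₃

end Regimes

section MeanViolation

variable {N : Network}

theorem pcond_add (hpx : N.px ≠ 0) : N.pcond .ec + N.pcond .lc = 1 := by
  rw [pcond, pcond, ← add_div, div_self (right_ne_zero_of_mul hpx)]

variable (hζ : ∀ m, N.ζ m N.δ ≠ 0) (hpx : N.px ≠ 0)
include hζ hpx

theorem deliveryProb_eq_mul (a : ℕ) : N.deliveryProb a =
    N.px * (N.pcond .ec * N.delayCDF .ec a + N.pcond .lc * N.delayCDF .lc a) := by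
  have := right_ne_zero_of_mul hpx
  have := hζ .ec
  have := hζ .lc
  rw [deliveryProb, px, pcond, pcond, delayCDF, delayCDF, modeProb, modeProb]
  field_simp

variable (hround : ∀ m, 1 + N.δ + N.τ m ≤ N.τr)
include hround

theorem survival_eq_peakTail (a : ℕ) : survival N.deliveryProb N.τr a a =
    N.pcond .ec * N.peakTail .ec a + N.pcond .lc * N.peakTail .lc a := by
  have hτr : 0 < N.τr := by have := hround .ec; lia
  have hlc : N.pcond .lc = 1 - N.pcond .ec := by linarith [pcond_add hpx]
  induction a using Nat.strong_induction_on with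
  | _ a ih =>
  obtain ha | ha := lt_or_ge a N.τr
  · rw [peakTail_of_lt ha, peakTail_of_lt ha, mul_one, mul_one, pcond_add hpx]
    refine Finset.prod_eq_one fun d hd => ?_
    rw [Finset.mem_filter, Finset.mem_range] at hd
    exact absurd (hd.2.eq_of_lt_of_lt (hd.1.trans ha) ha) hd.1.ne
  · obtain ⟨b, rfl⟩ := Nat.exists_eq_add_of_le' ha
    rw [survival_add_period le_rfl (by lia) (Nat.add_mod_right _ _).symm,
      survival_congr (Nat.add_mod_right b N.τr), ih b (by lia), peakTail_add hround (hζ _),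
      peakTail_add hround (hζ _), deliveryProb_eq_mul hζ hpx, hlc]
    obtain hb | hb := lt_or_ge b N.τr
    · rw [peakTail_of_lt hb, peakTail_of_lt hb]
      ring
    · rw [delayCDF_eq_one (hζ _) ((hround _).trans hb),
        delayCDF_eq_one (hζ _) ((hround _).trans hb)]
      ring

theorem meanViolation_eq_sum_survival (v : ℝ) : N.meanViolation v =
    (∑ s ∈ Finset.range N.τr, survival N.deliveryProb N.τr (ageThreshold v) s) / N.px := by
  have hlc : N.pcond .lc = 1 - N.pcond .ec := by linarith [pcond_add hpx]
  have hsum (κ : ℕ) : ∑ a ∈ Finset.range κ, N.deliveryProb a * survival N.deliveryProb N.τr a a =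
      N.px * (N.pcond .ec * N.pcond .ec *
            ∑ a ∈ Finset.range κ, N.delayCDF .ec a * N.peakTail .ec a +
          N.pcond .ec * N.pcond .lc * ∑ a ∈ Finset.range κ, N.delayCDF .ec a * N.peakTail .lc a +
          N.pcond .lc * N.pcond .ec * ∑ a ∈ Finset.range κ, N.delayCDF .lc a * N.peakTail .ec a +
          N.pcond .lc * N.pcond .lc *
            ∑ a ∈ Finset.range κ, N.delayCDF .lc a * N.peakTail .lc a) := by
    simp only [Finset.mul_sum, ← Finset.sum_add_distrib]
    refine Finset.sum_congr rfl fun a _ => ?_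
    rw [survival_eq_peakTail hζ hpx hround, deliveryProb_eq_mul hζ hpx]
    ring
  have hτr : 0 < N.τr := by have := hround .ec; lia
  simp only [meanViolation, G_eq_cycleViolation hround hζ hpx, cycleViolation]
  rw [sum_survival hτr, hsum, hlc]
  field_simp
  ring

end MeanViolation

end Network

/-! ### Coverage -/

section ClosedBall

variable {E : Type*} [NormedAddCommGroup E] [NormedSpace ℝ E] [FiniteDimensional ℝ E]
  [Nontrivial E] [MeasurableSpace E] [BorelSpace E] (μ : Measure E) [μ.IsAddHaarMeasure]
  {x : E} {r R : ℝ}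

theorem measureReal_closedBall_lt_of_lt (hR : 0 < R) (h : r < R) :
    μ.real (Metric.closedBall x r) < μ.real (Metric.closedBall x R) := by
  have hunit : 0 < μ.real (Metric.ball (0 : E) 1) :=
    ENNReal.toReal_pos (Metric.measure_ball_pos μ 0 one_pos).ne' measure_ball_lt_top.ne
  calc μ.real (Metric.closedBall x r) ≤ μ.real (Metric.closedBall x (max r 0)) :=
        measureReal_mono (Metric.closedBall_subset_closedBall (le_max_left r 0))
          measure_closedBall_lt_top.ne
    _ = max r 0 ^ Module.finrank ℝ E * μ.real (Metric.ball 0 1) :=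
        Measure.addHaar_real_closedBall μ x (le_max_right r 0)
    _ < R ^ Module.finrank ℝ E * μ.real (Metric.ball 0 1) := by
        gcongr
        · exact Module.finrank_pos.ne'
        · exact max_lt h hR
    _ = μ.real (Metric.closedBall x R) := (Measure.addHaar_real_closedBall μ x hR.le).symm

theorem measureReal_closedBall_le_inter_iff {A : Set E} (hA : μ A ≠ ⊤) (hR : 0 < R)
    (hsub : Metric.closedBall x r ⊆ A ∨ Metric.closedBall x R ⊆ A) :
    μ.real (Metric.closedBall x R) ≤ μ.real (Metric.closedBall x r ∩ A) ↔ R ≤ r := by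
  constructor
  · contrapose!
    exact fun h => (measureReal_mono Set.inter_subset_left measure_closedBall_lt_top.ne).trans_lt
      (measureReal_closedBall_lt_of_lt μ hR h)
  · intro h
    have hball : Metric.closedBall x R ⊆ Metric.closedBall x r :=
      Metric.closedBall_subset_closedBall h
    exact measureReal_mono (Set.subset_inter hball (hsub.elim hball.trans id))
      (measure_ne_top_of_subset Set.inter_subset_right hA)

end ClosedBall

theorem measureReal_closedBall_sqrt_div_pi (x : Plane) {c : ℝ} (hc : 0 ≤ c) :
    volume.real (Metric.closedBall x √(c / Real.pi)) = c := by
  rw [measureReal_def, EuclideanSpace.volume_closedBall_fin_two, ENNReal.toReal_mul,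
    ENNReal.toReal_pow, ENNReal.toReal_ofReal (Real.sqrt_nonneg _),
    ENNReal.toReal_ofReal Real.pi_pos.le, Real.sq_sqrt (div_nonneg hc Real.pi_pos.le),
    div_mul_cancel₀ _ Real.pi_ne_zero]

namespace Network

/-- Radius of the disc that data of age `a` covers; negative when no point is covered. -/
noncomputable def coverageRadius (N : Network) (a : ℝ) : ℝ :=
  (-(Real.log (1 - N.ε₀) / 2) - N.β₂ * a) / N.β₁

variable {N : Network} {a : ℝ} (hβ₁ : 0 < N.β₁)
include hβ₁

theorem coverage_eq_closedBall (hε₀ : N.ε₀ < 1) :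
    N.coverage a = Metric.closedBall N.x (N.coverageRadius a) := by
  ext y
  rw [coverage, Set.mem_ofPred_eq, estError, ← Real.exp_nat_mul, sub_le_comm,
    ← Real.log_le_iff_le_exp (by linarith), Metric.mem_closedBall', coverageRadius, le_div_iff₀ hβ₁]
  push_cast
  constructor <;> intro h <;> linarith

variable (hβ₂ : 0 < N.β₂)
include hβ₂

theorem targetRadius_le_coverageRadius_iff : N.targetRadius ≤ N.coverageRadius a ↔ a ≤ N.vth := by
  have hdiff : N.vth - a = N.β₁ / N.β₂ * (N.coverageRadius a - N.targetRadius) := by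
    rw [vth, coverageRadius]
    field_simp
    ring
  rw [← sub_nonneg, ← sub_nonneg (b := a), hdiff, mul_nonneg_iff_of_pos_left (div_pos hβ₁ hβ₂)]

theorem le_coverageRatio_iff (hε₀ : N.ε₀ < 1) (hη : 0 < N.η) (hΦ_pos : 0 < volume N.Φ)
    (hΦ_fin : volume N.Φ < ⊤)
    (hincl : N.coverage a ⊆ N.Φ ∨ Metric.closedBall N.x N.targetRadius ⊆ N.Φ) :
    N.η ≤ N.coverageRatio a ↔ a ≤ N.vth := by
  have harea : 0 < N.area := ENNReal.toReal_pos hΦ_pos.ne' hΦ_fin.ne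
  have hball : volume.real (Metric.closedBall N.x N.targetRadius) = N.η * N.area :=
    measureReal_closedBall_sqrt_div_pi N.x (mul_pos hη harea).le
  have hradius : 0 < N.targetRadius :=
    Real.sqrt_pos.2 (div_pos (mul_pos hη harea) Real.pi_pos)
  rw [coverage_eq_closedBall hβ₁ hε₀] at hincl
  rw [coverageRatio, le_div_iff₀ harea, ← hball, coverage_eq_closedBall hβ₁ hε₀,
    measureReal_closedBall_le_inter_iff volume hΦ_fin.ne hradius hincl,
    targetRadius_le_coverageRadius_iff hβ₁ hβ₂]

end Network

/-! ### Violation and coverage probabilities -/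

namespace Network

namespace IsModel

variable {N : Network} {Ω : Type*} [MeasurableSpace Ω] {μ : Measure Ω}
  {ξ : (i : Source) → Ω → i.Val} (hmodel : N.IsModel ξ μ) (hδ : 1 ≤ N.δ) (hps : 0 < N.ps)
  (hpo : ∀ m, N.po m < 1)
include hmodel hδ hps hpo

theorem px_pos : 0 < N.px :=
  mul_pos hps (successProb_pos hmodel.po_nonneg hpo hδ hmodel.modeProb_nonneg)

variable (hround : ∀ m, 1 + N.δ + N.τ m ≤ N.τr)
include hround

theorem meanViolation_eq_sum_survival (v : ℝ) : N.meanViolation v =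
    (∑ s ∈ Finset.range N.τr, survival N.deliveryProb N.τr (ageThreshold v) s) / N.px :=
  Network.meanViolation_eq_sum_survival
    (fun m => (ζ_pos (hmodel.po_nonneg m) (hpo m) (Nat.one_le_iff_ne_zero.1 hδ)).ne')
    (hmodel.px_pos hδ hps hpo).ne' hround v

theorem isSteadyStateProb_staleSet (v : ℝ) :
    IsSteadyStateProb μ (fun t => staleSet (N.lag ξ) N.τr t (ageThreshold v))
      (N.px / N.τr * N.meanViolation v) := by
  have hpx := (hmodel.px_pos hδ hps hpo).ne'
  convert (hmodel.isLagSequence hδ hround hps hpo).isSteadyStateProb_staleSet (ageThreshold v)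
    using 1
  rw [hmodel.meanViolation_eq_sum_survival hδ hps hpo hround]
  field_simp

theorem isSteadyStateProb_lt_aoi (v : ℝ) :
    IsSteadyStateProb μ (fun t => {ω | v < N.aoi ξ t ω}) (N.px / N.τr * N.meanViolation v) := by
  have hlag := hmodel.isLagSequence hδ hround hps hpo
  refine (hmodel.isSteadyStateProb_staleSet hδ hps hpo hround v).congr ?_
  filter_upwards [eventually_ge_atTop (ageThreshold v)] with t ht
  exact (setOf_lt_aoi_eq_staleSet hlag.pos ht).symm

theorem isSteadyStateProb_aoi_le (v : ℝ) :
    IsSteadyStateProb μ (fun t => {ω | N.aoi ξ t ω ≤ v})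
      (1 - N.px / N.τr * N.meanViolation v) := by
  have := hmodel.isProbabilityMeasure
  have hlag := hmodel.isLagSequence hδ hround hps hpo
  refine ((hmodel.isSteadyStateProb_staleSet hδ hps hpo hround v).compl
    fun t => hlag.measurableSet_staleSet t _).congr ?_
  filter_upwards [eventually_ge_atTop (ageThreshold v)] with t ht
  rw [← setOf_lt_aoi_eq_staleSet hlag.pos ht]
  simp only [Set.compl_ofPred, not_lt]

theorem isSteadyStateProb_le_coverageRatio (hβ₁ : 0 < N.β₁) (hβ₂ : 0 < N.β₂) (hε₀ : N.ε₀ < 1)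
    (hη : 0 < N.η) (hΦ_pos : 0 < volume N.Φ) (hΦ_fin : volume N.Φ < ⊤)
    (hincl : (∀ (m : Mode) (a : ℝ), 2 + N.τ m ≤ a → N.coverage a ⊆ N.Φ) ∨
      Metric.closedBall N.x N.targetRadius ⊆ N.Φ) :
    IsSteadyStateProb μ (fun t => {ω | N.η ≤ N.coverageRatio (N.aoi ξ t ω)})
      (1 - N.px / N.τr * N.meanViolation N.vth) := by
  refine (hmodel.isSteadyStateProb_aoi_le hδ hps hpo hround N.vth).congr ?_
  filter_upwards [eventually_ge_atTop (2 + N.τ .ec)] with t ht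
  ext ω
  obtain ⟨m, hm⟩ := exists_two_add_le_aoi (ξ := ξ) ht ω
  exact (le_coverageRatio_iff hβ₁ hβ₂ hε₀ hη hΦ_pos hΦ_fin (hincl.imp_left fun h => h m _ hm)).symm

theorem ae_U_eq_violationTime (k : ℕ) :
    N.U ξ (k + 1) =ᵐ[μ] fun ω => (violationTime (N.lag ξ) N.τr k 0 ω : ℝ) := by
  filter_upwards [(hmodel.isLagSequence hδ hround hps hpo).ae_infinite] with ω hω
  exact U_eq_violationTime hω (fun j => lag_le hround j ω) k

theorem ae_g_eq_violationTime (v : ℝ) (k : ℕ) : N.g ξ v (k + 1) =ᵐ[μ]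
    fun ω => (violationTime (N.lag ξ) N.τr k (ageThreshold v) ω : ℝ) := by
  filter_upwards [(hmodel.isLagSequence hδ hround hps hpo).ae_infinite] with ω hω
  exact g_eq_violationTime hω (fun j => lag_le hround j ω) v k

theorem integrable_U (k : ℕ) : Integrable (N.U ξ (k + 1)) μ :=
  ((hmodel.isLagSequence hδ hround hps hpo).integrable_violationTime k 0).congr
    (hmodel.ae_U_eq_violationTime hδ hps hpo hround k).symm

theorem integral_U (k : ℕ) : ∫ ω, N.U ξ (k + 1) ω ∂μ = N.τr / N.px := by
  have hlag := hmodel.isLagSequence hδ hround hps hpo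
  rw [integral_congr_ae (hmodel.ae_U_eq_violationTime hδ hps hpo hround k),
    hlag.integral_violationTime, sum_survival hlag.pos, Finset.sum_range_zero, sub_zero,
    deliveryProb_eq_px hround le_rfl]

theorem integrable_g (v : ℝ) (k : ℕ) : Integrable (N.g ξ v (k + 1)) μ :=
  ((hmodel.isLagSequence hδ hround hps hpo).integrable_violationTime k (ageThreshold v)).congr
    (hmodel.ae_g_eq_violationTime hδ hps hpo hround v k).symm

theorem integral_g (v : ℝ) (k : ℕ) : ∫ ω, N.g ξ v (k + 1) ω ∂μ = N.meanViolation v := by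
  rw [integral_congr_ae (hmodel.ae_g_eq_violationTime hδ hps hpo hround v k),
    (hmodel.isLagSequence hδ hround hps hpo).integral_violationTime,
    hmodel.meanViolation_eq_sum_survival hδ hps hpo hround, deliveryProb_eq_px hround le_rfl]

end IsModel

end Network

theorem mainTheorem3 {Ω : Type*} [MeasurableSpace Ω] (μ : Measure Ω) [IsProbabilityMeasure μ]
    (N : Network) (ξ : (i : Source) → Ω → i.Val) (hmodel : N.IsModel ξ μ)
    (hδ : 1 ≤ N.δ) (hround : ∀ m, 1 + N.δ + N.τ m ≤ N.τr)
    (hps : 0 < N.ps) (hpo : ∀ m, N.po m < 1)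
    (hβ₁ : 0 < N.β₁) (hβ₂ : 0 < N.β₂) (hε₀ : N.ε₀ < 1) (hη : 0 < N.η)
    (hΦ : MeasurableSet N.Φ) (hΦ_pos : 0 < volume N.Φ) (hΦ_fin : volume N.Φ < ⊤)
    -- the sensing coverage of any data at the sink, or at least the part of it that is needed to
    -- decide whether the target ratio is reached, lies in the network region
    (hincl : (∀ (m : Mode) (a : ℝ), 2 + N.τ m ≤ a → N.coverage a ⊆ N.Φ) ∨
      Metric.closedBall N.x N.targetRadius ⊆ N.Φ) :
    -- the coverage probability
    IsSteadyStateProb μ (fun t => {ω | N.η ≤ N.coverageRatio (N.aoi ξ t ω)})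
      (1 - N.px / N.τr * N.meanViolation N.vth) ∧
    -- it is the complement of the violation probability of the target age
    (∃ q, IsSteadyStateProb μ (fun t => {ω | N.vth < N.aoi ξ t ω}) q ∧
      1 - N.px / N.τr * N.meanViolation N.vth = 1 - q ∧
      -- which is the ratio of the mean violation time and the mean inter-update time
      ∀ k, 1 ≤ k →
        Integrable (N.U ξ k) μ ∧ Integrable (N.g ξ N.vth k) μ ∧
        (∫ ω, N.U ξ k ω ∂μ) = N.τr / N.px ∧
        (∫ ω, N.g ξ N.vth k ω ∂μ) = N.meanViolation N.vth ∧
        q = (∫ ω, N.g ξ N.vth k ω ∂μ) / ∫ ω, N.U ξ k ω ∂μ) := by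
  refine ⟨hmodel.isSteadyStateProb_le_coverageRatio hδ hps hpo hround hβ₁ hβ₂ hε₀ hη hΦ_pos hΦ_fin
    hincl, N.px / N.τr * N.meanViolation N.vth,
    hmodel.isSteadyStateProb_lt_aoi hδ hps hpo hround N.vth, rfl, fun k hk => ?_⟩
  obtain ⟨k, rfl⟩ := Nat.exists_eq_add_of_le' hk
  have hU := hmodel.integral_U hδ hps hpo hround k
  have hg := hmodel.integral_g hδ hps hpo hround N.vth k
  refine ⟨hmodel.integrable_U hδ hps hpo hround k, hmodel.integrable_g hδ hps hpo hround N.vth k,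
    hU, hg, ?_⟩
  rw [hU, hg]
  field_simp
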